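/- For an integer $R$ with $|R|>1$ and finite sets $D,L\subset\mathbb{Z}$ with $\#D=\#L$, call $(R,D,L)$ a Hadamard triple if the matrix $H=\frac{1}{\sqrt{\#D}}\left[e^{2\pi i d\ell/R}\right]_{\ell\in L,\,d\in D}$ satisfies $H^*H=I$. For a finite set $A\subset\mathbb{R}$ put $\delta_A=\frac1{\#A}\sum_{a\in A}\delta_a$. Given integers $p_n$ with $|p_n|>1$ and finite non-empty sets $\mathcal{D}_n\subset\mathbb{Z}$ ($n\ge1$), the Moran measure $\mu_{\{p_n,\mathcal{D}_n\}}$ is, if it exists, the Borel probability measure on $\mathbb{R}$ that is the weak limit of $\mu_n=\delta_{p_1^{-1}\mathcal{D}_1}*\delta_{(p_1p_2)^{-1}\mathcal{D}_2}*\cdots*\delta_{(p_1\cdots p_n)^{-1}\mathcal{D}_n}$, where the $\mu_n$ and the limit are all supported on one compact set. A Borel probability measure $\mu$ on $\mathbb{R}$ is called spectral if there is a countable set $\Lambda\subset\mathbb{R}$ such that $\{e^{2\pi i\lambda x}:\lambda\in\Lambda\}$ is an orthogonal basis of $L^2(\mu)$. **Proposition.** In each of the following two cases there are sets $L_n\subset\mathbb{Z}$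 such that $(p_n,\mathcal{D}_n,L_n)$ is a Hadamard triple for every $n\ge1$, one has $\sup_n\#\mathcal{D}_n<\infty$ and $\sup_n\{p_n^{-1}d:d\in\mathcal{D}_n\}=\infty$, and the Moran measure $\mu_{\{p_n,\mathcal{D}_n\}}$ exists. Moreover: (i) if $p_n=9$ and $\mathcal{D}_n=\{0,2,4^n\}$ for all $n\ge1$, then $\mu_{\{p_n,\mathcal{D}_n\}}$ is not a spectral measure; (ii) if $p_n=3n$ and $\mathcal{D}_n=\{0,2,3n^2+1\}$ for all $n\ge1$, then $\mu_{\{p_n,\mathcal{D}_n\}}$ is a spectral measure. -/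

import Mathlib

open MeasureTheory Filter Topology

noncomputable section

namespace CantorMoran

/-- `(R, D, L)` is a Hadamard triple on `ℝ`: `R` is an integer with `|R| > 1`, `D` and `L` are
finite sets of integers with the same number of elements, and the matrix
`H = (#D)^(-1/2) [exp (2 π i d ℓ / R)]`, with rows `ℓ ∈ L` and columns `d ∈ D`,
satisfies `H* H = I`. -/
def IsHadamardTriple (R : ℤ) (D L : Finset ℤ) : Prop :=
  1 < |R| ∧ D.card = L.card ∧
    let H : Matrix L D ℂ := Matrix.of fun l d =>
      ((1 / Real.sqrt (D.card : ℝ) : ℝ) : ℂ) *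
        Complex.exp (2 * Real.pi * Complex.I * (((d : ℤ) : ℂ) * ((l : ℤ) : ℂ) / (R : ℂ)))
    H.conjTranspose * H = 1

/-- The uniform measure `δ_A = (1/#A) ∑_{a ∈ A} δ_a` on a finite set `A` of reals. -/
def uniformMeasure (A : Finset ℝ) : Measure ℝ :=
  (A.card : ENNReal)⁻¹ • ∑ a ∈ A, Measure.dirac a

/-- The finite set `(p_1 p_2 ⋯ p_n)⁻¹ D_n`. Sequences are indexed by `n ≥ 1`. -/
def scaledDigits (p : ℕ → ℤ) (D : ℕ → Finset ℤ) (n : ℕ) : Finset ℝ :=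
  (D n).image fun d : ℤ => (d : ℝ) / ((∏ j ∈ Finset.Icc 1 n, p j : ℤ) : ℝ)

/-- The finite convolution
`μ_n = δ_{p_1⁻¹ D_1} ∗ δ_{(p_1 p_2)⁻¹ D_2} ∗ ⋯ ∗ δ_{(p_1 ⋯ p_n)⁻¹ D_n}`
(with `μ_0 = δ_0`, the neutral element of convolution). -/
def partialMoran (p : ℕ → ℤ) (D : ℕ → Finset ℤ) : ℕ → Measure ℝ
  | 0 => Measure.dirac 0
  | n + 1 => (partialMoran p D n).conv (uniformMeasure (scaledDigits p D (n + 1)))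

/-- `μ` is the Moran measure of the sequence `(p_n, D_n)_{n ≥ 1}`: a Borel probability measure on
the line, the weak limit of the finite convolutions `μ_n`, all of these measures being supported
on one compact set `T`. -/
def IsMoranMeasure (p : ℕ → ℤ) (D : ℕ → Finset ℤ) (μ : ProbabilityMeasure ℝ) : Prop :=
  (∃ T : Set ℝ, IsCompact T ∧ (μ : Measure ℝ) Tᶜ = 0 ∧ ∀ n, 1 ≤ n → partialMoran p D n Tᶜ = 0) ∧
  ∀ f : ℝ → ℝ, Continuous f → HasCompactSupport f →
    Tendsto (fun n => ∫ x, f x ∂(partialMoran p D n)) atTop (𝓝 (∫ x, f x ∂(μ : Measure ℝ)))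

theorem memLp_exp (μ : ProbabilityMeasure ℝ) (t : ℝ) :
    MemLp (fun x : ℝ => Complex.exp (2 * Real.pi * Complex.I * (t * x))) 2 (μ : Measure ℝ) := by
  refine MemLp.of_bound (Continuous.aestronglyMeasurable (by fun_prop)) 1
    (Eventually.of_forall fun x => le_of_eq ?_)
  have h : (2 * Real.pi * Complex.I * (t * x) : ℂ)
      = ((2 * Real.pi * (t * x) : ℝ) : ℂ) * Complex.I := by
    push_cast; ring
  rw [h, Complex.norm_exp_ofReal_mul_I]

/-- The exponential `x ↦ exp (2 π i t x)` as an element of the complex Hilbert space `L²(μ)`. -/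
def expL2 (μ : ProbabilityMeasure ℝ) (t : ℝ) : Lp ℂ 2 (μ : Measure ℝ) :=
  (memLp_exp μ t).toLp _

/-- `Λ` is a spectrum of `μ`: it is countable and the family `exp (2 π i t x)`, `t ∈ Λ`, is an
orthogonal basis of `L²(μ)`, i.e. pairwise orthogonal with dense linear span. -/
def IsSpectrum (μ : ProbabilityMeasure ℝ) (Λ : Set ℝ) : Prop :=
  Λ.Countable ∧
  (∀ s ∈ Λ, ∀ t ∈ Λ, s ≠ t → inner ℂ (expL2 μ s) (expL2 μ t) = 0) ∧
  (Submodule.span ℂ (expL2 μ '' Λ)).topologicalClosure = ⊤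

/-- `μ` is a spectral measure: it has a spectrum. -/
def IsSpectralMeasure (μ : ProbabilityMeasure ℝ) : Prop :=
  ∃ Λ : Set ℝ, IsSpectrum μ Λ

/-- `sup_n {p_n⁻¹ d : d ∈ D_n} < ∞`, over `n ≥ 1`. -/
def BoundedDigits (p : ℕ → ℤ) (D : ℕ → Finset ℤ) : Prop :=
  BddAbove {x : ℝ | ∃ n : ℕ, 1 ≤ n ∧ ∃ d ∈ D n, x = (d : ℝ) / (p n : ℝ)}

/-- `(p_n, D_n)_{n ≥ 1}` extends to a sequence of Hadamard triples `(p_n, D_n, L_n)`,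
with `sup_n #D_n < ∞`. -/
def IsHadamardSequence (p : ℕ → ℤ) (D : ℕ → Finset ℤ) : Prop :=
  (∃ L : ℕ → Finset ℤ, ∀ n, 1 ≤ n → IsHadamardTriple (p n) (D n) (L n)) ∧
  ∃ C : ℕ, ∀ n, 1 ≤ n → (D n).card ≤ C

/-- `p_n = 9`. -/
def pA (_ : ℕ) : ℤ := 9

/-- `D_n = {0, 2, 4^n}`. -/
def DA (n : ℕ) : Finset ℤ := {0, 2, 4 ^ n}

/-- `p_n = 3 n`. -/
def pB (n : ℕ) : ℤ := 3 * n

/-- `D_n = {0, 2, 3 n² + 1}`. -/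
def DB (n : ℕ) : Finset ℤ := {0, 2, 3 * (n : ℤ) ^ 2 + 1}

end CantorMoran

end

noncomputable section

namespace CantorMoran

/-! ### The uniform measures and existence of the Moran measure -/

/-! Every digit set has three elements, so the Fourier transform of `μ` is an infinite product of
masks `(1 + e(ta) + e(tb)) / 3`. The scaled digits are summable in case (i), and there the product
vanishes only where a single mask does.

Case (i). A spectrum `Λ` satisfies Parseval's identity `∑ |μ̂(ξ + λ)|² = 1` for every `ξ`. A
dimension count in the `3 ^ N`-dimensional coding space shows that some translate of `Λ` avoids any
prescribed interval around `0` (`exists_gap`). On the other hand, an orthogonal set of sufficiently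
large frequencies carries mass at most `1/2` (`exists_far_mass_le`), a contradiction. The mass is
small because a frequency `t` of size `9 ^ K` still meets the digits `4 ^ k` after level `K`: the
phase `(4/9)^k t` remains large there, and each level at which it is far from the integers costs a
factor `rho`. A long run of near-integers forces divisibility by a high power of `9`, so about `log
K` losses are certain (`exists_far_orbit`). This is only a small negative power of `K`, not summable
over all layers `K`. Hence the layers in `(X, 2X]`, `X = 2 ^ j`, are estimated together
(`sum_dyadic_le`). Two facts help: frequencies with equally many far levels obey a single Bessel
inequality across layers (`sum_weightA_farCount`), and frequencies with few later losses lie in few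
short intervals (`exists_finset_round`). The resulting bounds are summable in `j`.

Case (ii). The integers `∑ c_k P_{k+1} / 3` with `c_k ∈ {0, 1, 2}` and `P_k = p_1 ⋯ p_k` form a
spectrum. Parseval on `ℤ/3` gives the identity exactly for the finite convolutions
(`sum_prod_maskB`). The limit is taken by dominated convergence, because `P_k` grows fast enough
that the masks beyond level `n` stay bounded below for `|x| ≤ 2 P_n` (`prod_maskB_le_norm_ft`). -/

theorem isProbabilityMeasure_uniformMeasure {A : Finset ℝ} (hA : A.Nonempty) :
    IsProbabilityMeasure (uniformMeasure A) := by
  refine ⟨?_⟩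
  have h : (A.card : ENNReal) ≠ 0 := by
    simpa using hA.ne_empty
  simp only [uniformMeasure, Measure.smul_apply, Measure.finsetSum_apply, measure_univ,
    Finset.sum_const, nsmul_eq_mul, mul_one, smul_eq_mul]
  exact ENNReal.inv_mul_cancel h (ENNReal.natCast_ne_top _)

theorem uniformMeasure_compl {A : Finset ℝ} {T : Set ℝ} (hT : MeasurableSet T)
    (hA : ∀ a ∈ A, a ∈ T) : uniformMeasure A Tᶜ = 0 := by
  simp only [uniformMeasure, Measure.smul_apply, Measure.finsetSum_apply, smul_eq_mul]
  rw [Finset.sum_eq_zero, mul_zero]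
  intro a ha
  rw [Measure.dirac_apply' _ hT.compl]
  simp [hA a ha]

theorem scaledDigits_nonempty {p : ℕ → ℤ} {D : ℕ → Finset ℤ} {n : ℕ} (h : (D n).Nonempty) :
    (scaledDigits p D n).Nonempty := h.image _

theorem isProbabilityMeasure_partialMoran {p : ℕ → ℤ} {D : ℕ → Finset ℤ}
    (hD : ∀ n, 1 ≤ n → (D n).Nonempty) (n : ℕ) : IsProbabilityMeasure (partialMoran p D n) := by
  induction n with
  | zero => exact Measure.dirac.isProbabilityMeasure
  | succ n ih =>
    have := isProbabilityMeasure_uniformMeasure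
      (scaledDigits_nonempty (p := p) (hD (n + 1) (by omega)))
    exact inferInstanceAs (IsProbabilityMeasure (_ ∗ _))

/-- Under the product of the uniform measures the partial sums of the coordinates have the law
`partialMoran`. -/
theorem map_sum_infinitePi {p : ℕ → ℤ} {D : ℕ → Finset ℤ}
    (hD : ∀ n, 1 ≤ n → (D n).Nonempty) (n : ℕ) :
    (Measure.infinitePi fun k => uniformMeasure (scaledDigits p D (k + 1))).map
      (fun ω : ℕ → ℝ => ∑ k ∈ Finset.range n, ω k) = partialMoran p D n := by
  have hP : ∀ k, IsProbabilityMeasure (uniformMeasure (scaledDigits p D (k + 1))) := fun k =>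
    isProbabilityMeasure_uniformMeasure (scaledDigits_nonempty (hD (k + 1) (by omega)))
  induction n with
  | zero =>
    simp only [Finset.range_zero, Finset.sum_empty, partialMoran]
    rw [Measure.map_const, measure_univ, one_smul]
  | succ n ih =>
    have hind := ProbabilityTheory.iIndepFun_infinitePi
      (P := fun k => uniformMeasure (scaledDigits p D (k + 1)))
      (X := fun _ (x : ℝ) => x) (fun _ => measurable_id)
    have h2 := hind.indepFun_finsetSum_of_notMem
      (fun i => measurable_pi_apply i) (s := Finset.range n) (i := n) (by simp)
    have h0 : (∑ j ∈ Finset.range n, fun ω : ℕ → ℝ => ω j)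
        = fun ω => ∑ j ∈ Finset.range n, ω j := by
      ext ω
      simp
    rw [h0] at h2
    have h3 := h2.map_add_eq_map_conv_map
      (Finset.measurable_sum _ fun i _ => measurable_pi_apply i) (measurable_pi_apply n)
    rw [partialMoran, ← ih]
    have h4 : Measure.map (fun ω : ℕ → ℝ => ω n)
        (Measure.infinitePi fun k => uniformMeasure (scaledDigits p D (k + 1)))
        = uniformMeasure (scaledDigits p D (n + 1)) :=
      (measurePreserving_eval_infinitePi
        (fun k => uniformMeasure (scaledDigits p D (k + 1))) n).map_eq
    rw [h4] at h3
    convert h3 using 2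
    ext ω
    simp [Finset.sum_range_succ]

/-- The Moran measure exists as soon as the scaled digits are bounded by a summable sequence. -/
theorem exists_isMoranMeasure {p : ℕ → ℤ} {D : ℕ → Finset ℤ}
    (hD : ∀ n, 1 ≤ n → (D n).Nonempty) {c : ℕ → ℝ} (hc : Summable c)
    (hb : ∀ n, ∀ x ∈ scaledDigits p D (n + 1), |x| ≤ c n) :
    ∃ μ : ProbabilityMeasure ℝ, IsMoranMeasure p D μ := by
  have hP : ∀ k, IsProbabilityMeasure (uniformMeasure (scaledDigits p D (k + 1))) := fun k =>
    isProbabilityMeasure_uniformMeasure (scaledDigits_nonempty (hD (k + 1) (by omega)))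
  -- The limit is realized as the law of the random series of independent digits, which converges
  -- almost surely.
  set Pr := Measure.infinitePi fun k => uniformMeasure (scaledDigits p D (k + 1)) with hPr
  have hc0 : ∀ n, 0 ≤ c n := fun n => by
    obtain ⟨x, hx⟩ := scaledDigits_nonempty (p := p) (hD (n + 1) (by omega))
    exact (abs_nonneg x).trans (hb n x hx)
  have hae : ∀ᵐ ω ∂Pr, ∀ k, |ω k| ≤ c k := by
    rw [ae_all_iff]
    intro k
    have hk := (measurePreserving_eval_infinitePi
      (fun k => uniformMeasure (scaledDigits p D (k + 1))) k)
    have hm : ∀ᵐ x ∂(uniformMeasure (scaledDigits p D (k + 1))), |x| ≤ c k := by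
      rw [ae_iff]
      have := uniformMeasure_compl (A := scaledDigits p D (k + 1)) (T := {x | |x| ≤ c k})
        (measurableSet_le measurable_id.abs measurable_const) (hb k)
      exact this
    exact hk.quasiMeasurePreserving.ae hm
  set X : (ℕ → ℝ) → ℝ := fun ω => ∑' k, ω k with hX
  have hS : ∀ n, Measurable fun ω : ℕ → ℝ => ∑ k ∈ Finset.range n, ω k := fun n =>
    Finset.measurable_sum _ fun i _ => measurable_pi_apply i
  have hlim : ∀ᵐ ω ∂Pr, Tendsto (fun n => ∑ k ∈ Finset.range n, ω k) atTop (𝓝 (X ω)) := by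
    filter_upwards [hae] with ω hω
    exact (Summable.of_norm_bounded hc hω).hasSum.tendsto_sum_nat
  have hXm : AEMeasurable X Pr :=
    aemeasurable_of_tendsto_metrizable_ae atTop (fun n => (hS n).aemeasurable) hlim
  have hμ : IsProbabilityMeasure (Pr.map X) := Measure.isProbabilityMeasure_map hXm
  refine ⟨⟨Pr.map X, hμ⟩, ⟨Set.Icc (-(∑' k, c k)) (∑' k, c k), isCompact_Icc, ?_, ?_⟩, ?_⟩
  · change Pr.map X _ = 0
    rw [Measure.map_apply_of_aemeasurable hXm measurableSet_Icc.compl, ← nonpos_iff_eq_zero]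
    have : ∀ᵐ ω ∂Pr, X ω ∈ Set.Icc (-(∑' k, c k)) (∑' k, c k) := by
      filter_upwards [hae] with ω hω
      exact abs_le.mp (tsum_of_norm_bounded (f := fun k => ω k) hc.hasSum hω)
    exact (ae_iff.mp this).le
  · intro n _
    rw [← map_sum_infinitePi hD n, Measure.map_apply (hS n) measurableSet_Icc.compl,
      ← nonpos_iff_eq_zero]
    have : ∀ᵐ ω ∂Pr, (∑ k ∈ Finset.range n, ω k) ∈ Set.Icc (-(∑' k, c k)) (∑' k, c k) := by
      filter_upwards [hae] with ω hω
      refine abs_le.mp ((Finset.abs_sum_le_sum_abs _ _).trans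
        ((Finset.sum_le_sum fun k _ => hω k).trans ?_))
      exact hc.sum_le_tsum _ fun k _ => hc0 k
    exact (ae_iff.mp this).le
  · intro f hf hfc
    obtain ⟨C, hC⟩ := hf.bounded_above_of_compact_support hfc
    have h1 : ∀ n, ∫ x, f x ∂(partialMoran p D n)
        = ∫ ω, f (∑ k ∈ Finset.range n, ω k) ∂Pr := fun n => by
      rw [← map_sum_infinitePi hD n,
        integral_map (hS n).aemeasurable hf.aestronglyMeasurable]
    have h2 : ∫ x, f x ∂(Pr.map X) = ∫ ω, f (X ω) ∂Pr :=
      integral_map hXm hf.aestronglyMeasurable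
    simp only [h1]
    change Tendsto _ _ (𝓝 (∫ x, f x ∂(Pr.map X)))
    rw [h2]
    refine tendsto_integral_of_dominated_convergence (fun _ => C)
      (fun n => (hf.measurable.comp (hS n)).aestronglyMeasurable) (integrable_const _)
      (fun n => Eventually.of_forall fun ω => hC _) ?_
    filter_upwards [hlim] with ω hω
    exact (hf.tendsto _).comp hω

/-! ### Exponentials and masks -/

/-- `ex x = exp (2 π i x)`. -/
def ex (x : ℝ) : ℂ := Complex.exp (2 * Real.pi * Complex.I * x)

theorem ex_eq (x : ℝ) : ex x = Complex.exp ((2 * Real.pi * x : ℝ) * Complex.I) := by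
  rw [ex]; congr 1; push_cast; ring

theorem norm_ex (x : ℝ) : ‖ex x‖ = 1 := by rw [ex_eq, Complex.norm_exp_ofReal_mul_I]

theorem ex_zero : ex 0 = 1 := by simp [ex]

theorem ex_add (x y : ℝ) : ex (x + y) = ex x * ex y := by
  rw [ex, ex, ex, ← Complex.exp_add]; congr 1; push_cast; ring

theorem ex_neg (x : ℝ) : ex (-x) = (starRingEnd ℂ) (ex x) := by
  rw [ex_eq, ex_eq, ← Complex.exp_conj]
  congr 1
  rw [map_mul, Complex.conj_I, Complex.conj_ofReal]
  push_cast
  ring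

theorem ex_eq_one_iff (x : ℝ) : ex x = 1 ↔ ∃ n : ℤ, x = n := by
  rw [ex, Complex.exp_eq_one_iff]
  have h2 : (2 * Real.pi * Complex.I : ℂ) ≠ 0 := by
    simp [Real.pi_ne_zero]
  constructor
  · rintro ⟨n, hn⟩
    refine ⟨n, ?_⟩
    have : (x : ℂ) = n := by
      apply mul_left_cancel₀ h2
      rw [hn]; ring
    exact_mod_cast this
  · rintro ⟨n, rfl⟩
    exact ⟨n, by push_cast; ring⟩

theorem ex_intCast (n : ℤ) : ex n = 1 := (ex_eq_one_iff _).2 ⟨n, rfl⟩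

theorem ex_add_intCast (x : ℝ) (n : ℤ) : ex (x + n) = ex x := by
  rw [ex_add, ex_intCast, mul_one]

theorem continuous_ex : Continuous ex := by unfold ex; fun_prop

theorem norm_ex_sub_one_le (x : ℝ) : ‖ex x - 1‖ ≤ 2 * Real.pi * |x| := by
  have h := Real.norm_exp_I_mul_ofReal_sub_one_le (x := 2 * Real.pi * x)
  rw [mul_comm Complex.I, ← ex_eq] at h
  refine h.trans (le_of_eq ?_)
  rw [Real.norm_eq_abs, abs_mul, abs_of_pos Real.two_pi_pos]

theorem ex_re (x : ℝ) : (ex x).re = Real.cos (2 * Real.pi * x) := by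
  rw [ex_eq, Complex.exp_ofReal_mul_I_re]

theorem ex_im (x : ℝ) : (ex x).im = Real.sin (2 * Real.pi * x) := by
  rw [ex_eq, Complex.exp_ofReal_mul_I_im]

/-- The Fourier transform of the uniform measure on `{0, a, b}`. -/
def mask (a b t : ℝ) : ℂ := (1 + ex (t * a) + ex (t * b)) / 3

theorem norm_mask_le (a b t : ℝ) : ‖mask a b t‖ ≤ 1 := by
  rw [mask, norm_div]
  have h := norm_add₃_le (a := (1 : ℂ)) (b := ex (t * a)) (c := ex (t * b))
  rw [norm_ex, norm_ex, norm_one] at h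
  rw [show ‖(3 : ℂ)‖ = 3 by simp, div_le_one (by norm_num)]
  linarith

theorem mask_neg (a b t : ℝ) : mask a b (-t) = (starRingEnd ℂ) (mask a b t) := by
  simp only [mask, neg_mul, ex_neg, map_div₀, map_add, map_one, map_ofNat]

theorem norm_mask_sub_one_le (a b t : ℝ) :
    ‖mask a b t - 1‖ ≤ 2 * Real.pi / 3 * ((|a| + |b|) * |t|) := by
  have h : mask a b t - 1 = ((ex (t * a) - 1) + (ex (t * b) - 1)) / 3 := by
    rw [mask]; ring
  rw [h, norm_div, show ‖(3 : ℂ)‖ = 3 by simp, div_le_iff₀ (by norm_num)]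
  refine (norm_add_le _ _).trans ?_
  have h1 := norm_ex_sub_one_le (t * a)
  have h2 := norm_ex_sub_one_le (t * b)
  rw [abs_mul] at h1 h2
  nlinarith

/-- If `1 + z + w = 0` with `z, w` on the unit circle, then `z` is a primitive cube root of `1`. -/
theorem cube_eq_one_of_add_eq_zero {z w : ℂ} (hz : ‖z‖ = 1) (hw : ‖w‖ = 1) (h : 1 + z + w = 0) :
    z ^ 3 = 1 ∧ z ≠ 1 := by
  have hw' : w = -(1 + z) := by linear_combination h
  have h1 : z * (starRingEnd ℂ) z = 1 := by
    rw [Complex.mul_conj, Complex.normSq_eq_norm_sq, hz]; simp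
  have h2 : (1 + z) * (1 + (starRingEnd ℂ) z) = 1 := by
    have : w * (starRingEnd ℂ) w = 1 := by
      rw [Complex.mul_conj, Complex.normSq_eq_norm_sq, hw]; simp
    rw [hw'] at this
    simp only [map_neg, map_add, map_one] at this
    linear_combination this
  have h3 : z ^ 2 + z + 1 = 0 := by
    have : 1 + z + (starRingEnd ℂ) z = 0 := by linear_combination h2 - h1
    linear_combination z * this - h1
  refine ⟨by linear_combination (z - 1) * h3, ?_⟩
  rintro rfl
  norm_num at h3

theorem mask_eq_zero {a b t : ℝ} (h : mask a b t = 0) :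
    ∃ j : ℤ, ¬ (3 : ℤ) ∣ j ∧ t * a = j / 3 := by
  have h' : 1 + ex (t * a) + ex (t * b) = 0 := by
    rw [mask, div_eq_zero_iff] at h
    simpa using h
  obtain ⟨h3, h1⟩ := cube_eq_one_of_add_eq_zero (norm_ex _) (norm_ex _) h'
  have h4 : ex (3 * (t * a)) = 1 := by
    rw [show 3 * (t * a) = t * a + t * a + t * a by ring, ex_add, ex_add, ← h3]; ring
  obtain ⟨j, hj⟩ := (ex_eq_one_iff _).1 h4
  refine ⟨j, ?_, by linarith⟩
  rintro ⟨m, rfl⟩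
  refine h1 ((ex_eq_one_iff _).2 ⟨m, ?_⟩)
  push_cast at hj
  linarith

/-! ### The Fourier transform of a Moran measure with three digits at every level -/

/-- The Fourier transform `∫ exp (2 π i t x) dμ(x)`. -/
def ft (μ : Measure ℝ) (t : ℝ) : ℂ := ∫ x, ex (t * x) ∂μ

theorem ft_neg (μ : Measure ℝ) (t : ℝ) : ft μ (-t) = (starRingEnd ℂ) (ft μ t) := by
  rw [ft, ft, ← integral_conj]
  simp [neg_mul, ex_neg]

theorem norm_ft_neg (μ : Measure ℝ) (t : ℝ) : ‖ft μ (-t)‖ = ‖ft μ t‖ := by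
  rw [ft_neg, RCLike.norm_conj]

theorem ft_zero (μ : Measure ℝ) [IsProbabilityMeasure μ] : ft μ 0 = 1 := by
  simp [ft, ex_zero]

/-- At every level `n ≥ 1` the scaled digit set consists of the three numbers `0, α n, β n`. -/
def IsTernary (p : ℕ → ℤ) (D : ℕ → Finset ℤ) (α β : ℕ → ℝ) : Prop :=
  ∀ n, 1 ≤ n → scaledDigits p D n = {0, α n, β n} ∧ α n ≠ 0 ∧ β n ≠ 0 ∧ α n ≠ β n

section Ternary

variable {p : ℕ → ℤ} {D : ℕ → Finset ℤ} {α β : ℕ → ℝ}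

theorem IsTernary.nonempty (h : IsTernary p D α β) (n : ℕ) (hn : 1 ≤ n) : (D n).Nonempty := by
  have h1 : (scaledDigits p D n).Nonempty := by rw [(h n hn).1]; simp
  exact Finset.image_nonempty.1 h1

theorem integrable_ex (μ : Measure ℝ) [IsFiniteMeasure μ] (t : ℝ) :
    Integrable (fun x => ex (t * x)) μ :=
  Integrable.of_bound ((continuous_ex.comp (by fun_prop)).aestronglyMeasurable) 1
    (Eventually.of_forall fun x => (norm_ex _).le)

theorem ft_uniformMeasure {a b : ℝ} (ha : a ≠ 0) (hb : b ≠ 0) (hab : a ≠ b) (t : ℝ) :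
    ft (uniformMeasure {0, a, b}) t = mask a b t := by
  have hc : ({0, a, b} : Finset ℝ).card = 3 := by
    rw [Finset.card_eq_three]
    exact ⟨0, a, b, ha.symm, hb.symm, hab, rfl⟩
  rw [ft, uniformMeasure, integral_smul_measure, integral_finsetSum_measure
    (fun i _ => integrable_ex _ t), hc]
  rw [Finset.sum_insert (by simp [ha.symm, hb.symm]), Finset.sum_insert (by simp [hab]),
    Finset.sum_singleton]
  simp only [integral_dirac, mul_zero, ex_zero, mask]
  rw [Complex.real_smul]
  simp
  ring

theorem ft_partialMoran (h : IsTernary p D α β) (n : ℕ) (t : ℝ) :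
    ft (partialMoran p D n) t = ∏ k ∈ Finset.Icc 1 n, mask (α k) (β k) t := by
  induction n with
  | zero => simp [partialMoran, ft, ex_zero]
  | succ n ih =>
    have := isProbabilityMeasure_partialMoran (p := p) h.nonempty n
    have := isProbabilityMeasure_partialMoran (p := p) h.nonempty (n + 1)
    have hp := isProbabilityMeasure_uniformMeasure
      (scaledDigits_nonempty (p := p) (h.nonempty (n + 1) (by omega)))
    obtain ⟨h1, h2, h3, h4⟩ := h (n + 1) (by omega)
    rw [Finset.prod_Icc_succ_top (by omega), ← ih, ft, partialMoran, integral_conv]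
    · rw [← ft_uniformMeasure h2 h3 h4, ← h1]
      simp only [mul_add, ex_add, integral_const_mul, integral_mul_const]
      rfl
    · exact integrable_ex (partialMoran p D (n + 1)) t

/-- Exponentials are not compactly supported, so they are multiplied by a cutoff equal to `1` on the
common compact support; this changes none of the integrals. -/
theorem tendsto_ft (h : IsTernary p D α β) {μ : ProbabilityMeasure ℝ}
    (hμ : IsMoranMeasure p D μ) (t : ℝ) :
    Tendsto (fun n => ∏ k ∈ Finset.Icc 1 n, mask (α k) (β k) t) atTop
      (𝓝 (ft (μ : Measure ℝ) t)) := by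
  obtain ⟨⟨T, hT, hT0, hTn⟩, hw⟩ := hμ
  obtain ⟨χ, hχ1, -, hχc, -⟩ := exists_continuous_one_zero_of_isCompact hT
    (isClosed_empty : IsClosed (∅ : Set ℝ)) (by simp)
  have key : ∀ (ν : Measure ℝ) [IsProbabilityMeasure ν], ν Tᶜ = 0 →
      ft ν t = ((∫ x, χ x * Real.cos (2 * Real.pi * (t * x)) ∂ν : ℝ) : ℂ)
        + ((∫ x, χ x * Real.sin (2 * Real.pi * (t * x)) ∂ν : ℝ) : ℂ) * Complex.I := by
    intro ν _ hν
    have hae : ∀ᵐ x ∂ν, χ x = 1 := by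
      have : ∀ᵐ x ∂ν, x ∈ T := by rw [ae_iff]; exact hν
      filter_upwards [this] with x hx using hχ1 hx
    have h1 : ∫ x, χ x * Real.cos (2 * Real.pi * (t * x)) ∂ν = (ft ν t).re := by
      rw [ft, ← RCLike.re_eq_complex_re, ← integral_re (integrable_ex ν t)]
      refine integral_congr_ae ?_
      filter_upwards [hae] with x hx
      simp [hx, ex_re]
    have h2 : ∫ x, χ x * Real.sin (2 * Real.pi * (t * x)) ∂ν = (ft ν t).im := by
      rw [ft, ← RCLike.im_eq_complex_im, ← integral_im (integrable_ex ν t)]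
      refine integral_congr_ae ?_
      filter_upwards [hae] with x hx
      simp [hx, ex_im]
    rw [h1, h2, Complex.re_add_im]
  have hn : ∀ n, 1 ≤ n → ∏ k ∈ Finset.Icc 1 n, mask (α k) (β k) t
      = ((∫ x, χ x * Real.cos (2 * Real.pi * (t * x)) ∂(partialMoran p D n) : ℝ) : ℂ)
        + ((∫ x, χ x * Real.sin (2 * Real.pi * (t * x)) ∂(partialMoran p D n) : ℝ) : ℂ)
          * Complex.I := by
    intro n hn
    have := isProbabilityMeasure_partialMoran (p := p) h.nonempty n
    rw [← ft_partialMoran h, key _ (hTn n hn)]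
  rw [key _ hT0]
  have hcos := hw (fun x => χ x * Real.cos (2 * Real.pi * (t * x))) (by fun_prop) hχc.mul_right
  have hsin := hw (fun x => χ x * Real.sin (2 * Real.pi * (t * x))) (by fun_prop) hχc.mul_right
  refine Tendsto.congr' ?_ (((Complex.continuous_ofReal.tendsto _).comp hcos).add
    (((Complex.continuous_ofReal.tendsto _).comp hsin).mul_const Complex.I))
  filter_upwards [eventually_ge_atTop 1] with n hn1
  rw [hn n hn1]
  rfl

theorem norm_ft_le (h : IsTernary p D α β) {μ : ProbabilityMeasure ℝ}
    (hμ : IsMoranMeasure p D μ) (t : ℝ) (n : ℕ) :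
    ‖ft (μ : Measure ℝ) t‖ ≤ ∏ k ∈ Finset.Icc 1 n, ‖mask (α k) (β k) t‖ := by
  refine le_of_tendsto (tendsto_ft h hμ t).norm ?_
  filter_upwards [eventually_ge_atTop n] with m hm
  rw [norm_prod]
  rw [← Finset.prod_sdiff (Finset.Icc_subset_Icc_right hm)]
  exact mul_le_of_le_one_left (Finset.prod_nonneg fun i _ => norm_nonneg _)
    (Finset.prod_le_one (fun i _ => norm_nonneg _) fun i _ => norm_mask_le _ _ _)

theorem ft_eq_zero_of_mask (h : IsTernary p D α β) {μ : ProbabilityMeasure ℝ}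
    (hμ : IsMoranMeasure p D μ) {t : ℝ} {k : ℕ} (hk : 1 ≤ k) (hz : mask (α k) (β k) t = 0) :
    ft (μ : Measure ℝ) t = 0 := by
  have := norm_ft_le h hμ t k
  rw [Finset.prod_eq_zero (Finset.mem_Icc.2 ⟨hk, le_rfl⟩) (by rw [hz, norm_zero])] at this
  exact norm_le_zero_iff.1 this

/-- A lower bound for a product of numbers close to `1`. -/
theorem one_sub_sum_le_prod_norm {ι : Type*} (s : Finset ι) (z : ι → ℂ)
    (hz : ∀ i ∈ s, ‖z i‖ ≤ 1) : 1 - ∑ i ∈ s, ‖z i - 1‖ ≤ ∏ i ∈ s, ‖z i‖ := by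
  classical
  induction s using Finset.induction_on with
  | empty => simp
  | insert a s ha ih =>
    rw [Finset.sum_insert ha, Finset.prod_insert ha]
    have ih' := ih fun i hi => hz i (Finset.mem_insert_of_mem hi)
    have h1 : 1 - ‖z a - 1‖ ≤ ‖z a‖ := by
      have := norm_sub_norm_le (1 : ℂ) (1 - z a)
      rw [norm_one, norm_sub_rev 1 (z a), sub_sub_cancel] at this
      exact this
    have h2 := hz a (Finset.mem_insert_self _ _)
    have h3 : ∏ i ∈ s, ‖z i‖ ≤ 1 :=
      Finset.prod_le_one (fun i _ => norm_nonneg _)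
        fun i hi => hz i (Finset.mem_insert_of_mem hi)
    nlinarith [norm_nonneg (z a)]

/-- If the scaled digits are summable, then the zeros of the Fourier transform are the zeros of
the masks. -/
theorem exists_mask_eq_zero (h : IsTernary p D α β) {μ : ProbabilityMeasure ℝ}
    (hμ : IsMoranMeasure p D μ) (hs : Summable fun k => |α k| + |β k|) {t : ℝ}
    (ht : ft (μ : Measure ℝ) t = 0) : ∃ k, 1 ≤ k ∧ mask (α k) (β k) t = 0 := by
  by_contra! hne
  set f : ℕ → ℝ := fun k => 2 * Real.pi / 3 * ((|α k| + |β k|) * |t|) with hf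
  have hfs : Summable f := (hs.mul_right _).mul_left _
  have hf0 : ∀ k, 0 ≤ f k := fun k => by positivity
  -- Beyond a suitable `N` the deviations of the masks from `1` sum to less than `1/2`, so the tail
  -- of the product is at least `1/2`, while the head is a finite product of nonzero factors.
  have htail := tendsto_sum_nat_add f
  obtain ⟨N, hN⟩ := (htail.eventually_lt_const (by norm_num : (0 : ℝ) < 1 / 2)).exists
  set c := ∏ k ∈ Finset.Icc 1 N, ‖mask (α k) (β k) t‖ with hc
  have hcpos : 0 < c := Finset.prod_pos fun k hk =>
    norm_pos_iff.2 (hne k (Finset.mem_Icc.1 hk).1)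
  have hlow : ∀ m, N ≤ m → c / 2 ≤ ‖∏ k ∈ Finset.Icc 1 m, mask (α k) (β k) t‖ := by
    intro m hm
    rw [norm_prod, ← Finset.prod_sdiff (Finset.Icc_subset_Icc_right hm), ← hc]
    have h1 := one_sub_sum_le_prod_norm (Finset.Icc 1 m \ Finset.Icc 1 N)
      (fun k => mask (α k) (β k) t) (fun i _ => norm_mask_le _ _ _)
    have h2 : ∑ k ∈ Finset.Icc 1 m \ Finset.Icc 1 N, ‖mask (α k) (β k) t - 1‖ ≤ 1 / 2 := by
      calc ∑ k ∈ Finset.Icc 1 m \ Finset.Icc 1 N, ‖mask (α k) (β k) t - 1‖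
          ≤ ∑ k ∈ Finset.Icc 1 m \ Finset.Icc 1 N, f k :=
            Finset.sum_le_sum fun k _ => norm_mask_sub_one_le _ _ _
        _ ≤ ∑ k ∈ Finset.Ico N (m + 1), f k := by
            refine Finset.sum_le_sum_of_subset_of_nonneg ?_ fun k _ _ => hf0 k
            intro k hk
            simp only [Finset.mem_sdiff, Finset.mem_Icc, Finset.mem_Ico] at hk ⊢
            omega
        _ = ∑ k ∈ Finset.range (m + 1 - N), f (k + N) := by
            rw [Finset.sum_Ico_eq_sum_range]
            simp only [add_comm]
        _ ≤ ∑' k, f (k + N) :=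
            ((summable_nat_add_iff N).2 hfs).sum_le_tsum _ fun k _ => hf0 _
        _ ≤ 1 / 2 := hN.le
    nlinarith
  have : c / 2 ≤ ‖ft (μ : Measure ℝ) t‖ := by
    refine ge_of_tendsto (tendsto_ft h hμ t).norm ?_
    filter_upwards [eventually_ge_atTop N] with m hm using hlow m hm
  rw [ht, norm_zero] at this
  linarith

end Ternary

/-! ### Bessel's inequality on the finite coding spaces -/

section Coding

variable (α β : ℕ → ℝ)

/-- The exponential of frequency `t` of the first `K` of `N` digits, as a normalized vector. -/
def codeVec (N K : ℕ) (t : ℝ) : EuclideanSpace ℂ (Fin N → Fin 3) :=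
  WithLp.toLp 2 fun ω => ((Real.sqrt (3 ^ N))⁻¹ : ℝ) *
    ∏ i : Fin N, if (i : ℕ) + 1 ≤ K then
      ex (t * (![0, α (i + 1), β (i + 1)] : Fin 3 → ℝ) (ω i)) else 1

variable {α β}

/-- Both vectors are product functions on the coding space, so the sum over words factors into sums
over single letters. -/
theorem inner_codeVec (N K K' : ℕ) (t s : ℝ) :
    inner ℂ (codeVec α β N K t) (codeVec α β N K' s)
      = ∏ i : Fin N, (∑ c : Fin 3, (starRingEnd ℂ) (if (i : ℕ) + 1 ≤ K then
          ex (t * (![0, α (i + 1), β (i + 1)] : Fin 3 → ℝ) c) else 1) *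
          (if (i : ℕ) + 1 ≤ K' then
          ex (s * (![0, α (i + 1), β (i + 1)] : Fin 3 → ℝ) c) else 1)) / 3 := by
  rw [PiLp.inner_apply, Finset.prod_div_distrib, Finset.prod_univ_sum, Finset.sum_div,
    Fintype.piFinset_univ]
  refine Finset.sum_congr rfl fun ω _ => ?_
  have hs : (((Real.sqrt (3 ^ N))⁻¹ : ℝ) : ℂ) * (((Real.sqrt (3 ^ N))⁻¹ : ℝ) : ℂ)
      = (3 ^ N)⁻¹ := by
    rw [← Complex.ofReal_mul, ← mul_inv, Real.mul_self_sqrt (by positivity)]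
    push_cast; rfl
  simp only [codeVec, RCLike.inner_apply, map_mul, map_prod, Complex.conj_ofReal]
  rw [Finset.prod_mul_distrib, Finset.prod_const, Finset.card_univ, Fintype.card_fin,
    div_eq_mul_inv, ← hs]
  ring

theorem sum_ex_eq_mask (k : ℕ) (t s : ℝ) :
    (∑ c : Fin 3, (starRingEnd ℂ) (ex (t * (![0, α k, β k] : Fin 3 → ℝ) c)) *
      ex (s * (![0, α k, β k] : Fin 3 → ℝ) c)) / 3 = mask (α k) (β k) (s - t) := by
  simp only [Fin.sum_univ_three, ← ex_neg, ← ex_add, mask]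
  simp only [Matrix.cons_val_zero, Matrix.cons_val_one, Matrix.cons_val, mul_zero, neg_zero,
    add_zero, ex_zero]
  rw [← neg_mul, ← neg_mul, ← add_mul, ← add_mul, neg_add_eq_sub]

theorem inner_codeVec_eq_zero {N K K' : ℕ} {t s : ℝ} {k : ℕ} (hk : 1 ≤ k) (hN : k ≤ N)
    (hK : k ≤ K) (hK' : k ≤ K') (hz : mask (α k) (β k) (s - t) = 0) :
    inner ℂ (codeVec α β N K t) (codeVec α β N K' s) = 0 := by
  rw [inner_codeVec]
  refine Finset.prod_eq_zero (Finset.mem_univ (⟨k - 1, by omega⟩ : Fin N)) ?_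
  have h1 : k - 1 + 1 = k := by omega
  simp only [h1, hK, hK', if_true]
  rw [sum_ex_eq_mask, hz]

theorem norm_codeVec (N K : ℕ) (t : ℝ) : ‖codeVec α β N K t‖ = 1 := by
  have h : inner ℂ (codeVec α β N K t) (codeVec α β N K t) = (1 : ℂ) := by
    rw [inner_codeVec]
    refine Finset.prod_eq_one fun i _ => ?_
    by_cases hi : (i : ℕ) + 1 ≤ K
    · simp only [hi, if_true]
      rw [sum_ex_eq_mask, sub_self]
      simp only [mask, zero_mul, ex_zero]
      norm_num
    · simp [hi]
  have h2 : ‖codeVec α β N K t‖ ^ 2 = 1 := by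
    rw [← inner_self_eq_norm_sq (𝕜 := ℂ), h, RCLike.one_re]
  nlinarith [norm_nonneg (codeVec α β N K t)]

theorem norm_inner_codeVec_zero {N K : ℕ} (hK : K ≤ N) (t : ℝ) :
    ‖inner ℂ (codeVec α β N K t) (codeVec α β N N 0)‖
      = ∏ k ∈ Finset.Icc 1 K, ‖mask (α k) (β k) t‖ := by
  rw [inner_codeVec, norm_prod]
  have h1 : ∀ i : Fin N, ‖(∑ c : Fin 3, (starRingEnd ℂ) (if (i : ℕ) + 1 ≤ K then
          ex (t * (![0, α (i + 1), β (i + 1)] : Fin 3 → ℝ) c) else 1) *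
          (if (i : ℕ) + 1 ≤ N then
          ex (0 * (![0, α (i + 1), β (i + 1)] : Fin 3 → ℝ) c) else 1)) / 3‖
      = (fun k => if k + 1 ≤ K then ‖mask (α (k + 1)) (β (k + 1)) t‖ else 1) (i : ℕ) := by
    intro i
    have hN : (i : ℕ) + 1 ≤ N := i.2
    by_cases hi : (i : ℕ) + 1 ≤ K
    · simp only [hi, hN, if_true]
      rw [sum_ex_eq_mask, zero_sub, mask_neg, RCLike.norm_conj]
    · simp [hi, ex_zero]
  rw [Finset.prod_congr rfl fun i _ => h1 i, Fin.prod_univ_eq_prod_range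
    (fun k => if k + 1 ≤ K then ‖mask (α (k + 1)) (β (k + 1)) t‖ else 1) N, ← Finset.prod_filter]
  refine Finset.prod_bij' (fun k _ => k + 1) (fun k _ => k - 1) ?_ ?_ ?_ ?_ ?_
  · intro a ha
    simp only [Finset.mem_filter, Finset.mem_range, Finset.mem_Icc] at ha ⊢
    omega
  · intro a ha
    simp only [Finset.mem_filter, Finset.mem_range, Finset.mem_Icc] at ha ⊢
    omega
  · intros; simp
  · intro a ha
    simp only [Finset.mem_Icc] at ha
    omega
  · intros; rfl

theorem orthonormal_codeVec {N : ℕ} {S : Finset ℝ} {K : ℝ → ℕ} (hK : ∀ t ∈ S, K t ≤ N)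
    (hS : ∀ t ∈ S, ∀ s ∈ S, t ≠ s →
      ∃ k, 1 ≤ k ∧ k ≤ K t ∧ k ≤ K s ∧ mask (α k) (β k) (s - t) = 0) :
    Orthonormal ℂ fun t : S => codeVec α β N (K t) t := by
  refine ⟨fun t => norm_codeVec _ _ _, fun t s hts => ?_⟩
  obtain ⟨k, hk, h1, h2, hz⟩ := hS t t.2 s s.2 fun h => hts (Subtype.ext h)
  exact inner_codeVec_eq_zero hk (h1.trans (hK t t.2)) h1 h2 hz

/-- Bessel's inequality for exponentials of the finite convolutions, with a convolution of level
`K t` attached to the frequency `t`. -/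
theorem sum_prod_mask_le_one (S : Finset ℝ) (K : ℝ → ℕ)
    (hS : ∀ t ∈ S, ∀ s ∈ S, t ≠ s →
      ∃ k, 1 ≤ k ∧ k ≤ K t ∧ k ≤ K s ∧ mask (α k) (β k) (s - t) = 0) :
    ∑ t ∈ S, ∏ k ∈ Finset.Icc 1 (K t), ‖mask (α k) (β k) t‖ ^ 2 ≤ 1 := by
  set N := S.sup K
  have hK : ∀ t ∈ S, K t ≤ N := fun t ht => Finset.le_sup ht
  -- Bessel's inequality is applied to the normalized constant vector, which is the code vector of
  -- frequency `0`.
  have h := (orthonormal_codeVec hK hS).sum_inner_products_le (s := Finset.univ)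
    (codeVec α β N N 0)
  rw [norm_codeVec, one_pow] at h
  refine le_trans (le_of_eq ?_) h
  rw [← Finset.sum_coe_sort S]
  refine Finset.sum_congr rfl fun t _ => ?_
  rw [norm_inner_codeVec_zero (hK t t.2), Finset.prod_pow]

/-- The code vectors are orthonormal in a space of dimension `3 ^ N`. -/
theorem card_le_three_pow (S : Finset ℝ) (N : ℕ)
    (hS : ∀ t ∈ S, ∀ s ∈ S, t ≠ s → ∃ k, 1 ≤ k ∧ k ≤ N ∧ mask (α k) (β k) (s - t) = 0) :
    S.card ≤ 3 ^ N := by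
  have h := (orthonormal_codeVec (α := α) (β := β) (S := S) (K := fun _ => N) (fun _ _ => le_rfl)
    (fun t ht s hs hts => by
      obtain ⟨k, h1, h2, h3⟩ := hS t ht s hs hts
      exact ⟨k, h1, h2, h2, h3⟩)).linearIndependent.fintype_card_le_finrank
  simpa using h

end Coding

/-! ### Exponentials in `L²(μ)` -/

section L2

variable (μ : ProbabilityMeasure ℝ)

theorem expL2_coeFn (t : ℝ) : expL2 μ t =ᵐ[(μ : Measure ℝ)] fun x => ex (t * x) := by
  filter_upwards [(memLp_exp μ t).coeFn_toLp] with x hx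
  rw [expL2, hx, ex]
  push_cast
  rfl

theorem inner_expL2 (s t : ℝ) : inner ℂ (expL2 μ s) (expL2 μ t) = ft (μ : Measure ℝ) (t - s) := by
  rw [L2.inner_def, ft]
  refine integral_congr_ae ?_
  filter_upwards [expL2_coeFn μ s, expL2_coeFn μ t] with x h1 h2
  rw [h1, h2, RCLike.inner_apply, ← ex_neg, ← ex_add]
  congr 1
  ring

theorem norm_expL2 (t : ℝ) : ‖expL2 μ t‖ = 1 := by
  have h := inner_expL2 μ t t
  rw [sub_self, ft_zero] at h
  have h2 : ‖expL2 μ t‖ ^ 2 = 1 := by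
    rw [← inner_self_eq_norm_sq (𝕜 := ℂ), h, RCLike.one_re]
  nlinarith [norm_nonneg (expL2 μ t)]

theorem IsSpectrum.orthonormal {Λ : Set ℝ} (h : IsSpectrum μ Λ) :
    Orthonormal ℂ fun t : Λ => expL2 μ t :=
  ⟨fun t => norm_expL2 μ t, fun s t hst =>
    h.2.1 s s.2 t t.2 fun h' => hst (Subtype.ext h')⟩

/-- Parseval's identity for the unit vector `expL2 μ (-ξ)`. -/
theorem IsSpectrum.hasSum {Λ : Set ℝ} (h : IsSpectrum μ Λ) (ξ : ℝ) :
    HasSum (fun t : Λ => ‖ft (μ : Measure ℝ) (ξ + t)‖ ^ 2) 1 := by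
  have hspan : ⊤ ≤ (Submodule.span ℂ (Set.range fun t : Λ => expL2 μ t)).topologicalClosure := by
    rw [← h.2.2, Set.image_eq_range]
  set b := HilbertBasis.mk h.orthonormal hspan with hb
  have h1 := b.hasSum_inner_mul_inner (expL2 μ (-ξ)) (expL2 μ (-ξ))
  rw [inner_self_eq_norm_sq_to_K, norm_expL2] at h1
  have h2 := (RCLike.hasSum_re ℂ h1)
  simp only [hb, HilbertBasis.coe_mk, inner_expL2] at h2
  convert h2 using 1
  · ext t
    rw [show (t : ℝ) - -ξ = ξ + t by ring, show -ξ - (t : ℝ) = -(ξ + t) by ring, ft_neg,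
      RCLike.mul_conj]
    norm_cast
  · simp

/-- An integrable real function whose Fourier transform with respect to `μ` vanishes is zero. -/
theorem ae_eq_zero_of_integral_ex (ν : Measure ℝ) [IsFiniteMeasure ν] {g : ℝ → ℝ}
    (hg : Integrable g ν) (h0 : ∀ t, ∫ x, ex (t * x) * (g x : ℂ) ∂ν = 0) : g =ᵐ[ν] 0 := by
  have hm1 : AEMeasurable (fun x => ENNReal.ofReal (g x)) ν := hg.aemeasurable.ennreal_ofReal
  have hm2 : AEMeasurable (fun x => ENNReal.ofReal (-g x)) ν :=
    hg.aemeasurable.neg.ennreal_ofReal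
  have hf1 : ∫⁻ x, ENNReal.ofReal (g x) ∂ν ≠ ⊤ := hg.lintegral_lt_top.ne
  have hf2 : ∫⁻ x, ENNReal.ofReal (-g x) ∂ν ≠ ⊤ := hg.neg.lintegral_lt_top.ne
  have := isFiniteMeasure_withDensity hf1
  have := isFiniteMeasure_withDensity hf2
  have hexp : ∀ (t : ℝ) (u : ℝ → ℝ), Integrable u ν →
      Integrable (fun x => u x • Complex.exp (t * x * Complex.I)) ν := by
    intro t u hu
    simp only [Complex.real_smul, mul_comm (Complex.ofReal _) (Complex.exp _)]
    refine hu.ofReal.bdd_mul (c := 1) (Continuous.aestronglyMeasurable (by fun_prop))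
      (Eventually.of_forall fun x => le_of_eq ?_)
    rw [show (t * x * Complex.I : ℂ) = ((t * x : ℝ) : ℂ) * Complex.I by push_cast; ring,
      Complex.norm_exp_ofReal_mul_I]
  -- The positive and negative parts of `g` define finite measures with the same characteristic
  -- function, hence equal measures.
  have key : ν.withDensity (fun x => ENNReal.ofReal (g x))
      = ν.withDensity (fun x => ENNReal.ofReal (-g x)) := by
    refine Measure.ext_of_charFun (funext fun t => ?_)
    rw [charFun_apply_real, charFun_apply_real,
      integral_withDensity_eq_integral_toReal_smul₀ hm1 (by simp),
      integral_withDensity_eq_integral_toReal_smul₀ hm2 (by simp), ← sub_eq_zero,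
      ← integral_sub, ← h0 (t / (2 * Real.pi))]
    · refine integral_congr_ae (Eventually.of_forall fun x => ?_)
      have h1 : (ENNReal.ofReal (g x)).toReal - (ENNReal.ofReal (-g x)).toReal = g x := by
        rw [ENNReal.toReal_ofReal', ENNReal.toReal_ofReal']
        rcases le_total (g x) 0 with h | h
        · rw [max_eq_right h, max_eq_left (by linarith)]; ring
        · rw [max_eq_left h, max_eq_right (by linarith)]; ring
      have h2 : ex (t / (2 * Real.pi) * x) = Complex.exp (t * x * Complex.I) := by
        rw [ex]
        congr 1
        have : (Real.pi : ℂ) ≠ 0 := by exact_mod_cast Real.pi_ne_zero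
        push_cast
        field_simp
      have h3 : (g x : ℂ) = ((ENNReal.ofReal (g x)).toReal : ℂ)
          - ((ENNReal.ofReal (-g x)).toReal : ℂ) := by
        rw [← Complex.ofReal_sub, h1]
      beta_reduce
      rw [h2, h3]
      simp only [Complex.real_smul]
      ring
    · exact hexp t _ (integrable_toReal_of_lintegral_ne_top hm1 hf1)
    · exact hexp t _ (integrable_toReal_of_lintegral_ne_top hm2 hf2)
  rw [withDensity_eq_iff hm1 hm2 hf1] at key
  filter_upwards [key] with x hx
  rcases le_total (g x) 0 with h | h
  · rw [ENNReal.ofReal_of_nonpos h] at hx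
    have := ENNReal.ofReal_eq_zero.1 hx.symm
    simp only [Pi.zero_apply]
    linarith
  · rw [ENNReal.ofReal_of_nonpos (by linarith : -g x ≤ 0)] at hx
    have := ENNReal.ofReal_eq_zero.1 hx
    simp only [Pi.zero_apply]
    linarith

/-- A function in `L²(μ)` orthogonal to all exponentials vanishes. -/
theorem eq_zero_of_inner_expL2 (f : Lp ℂ 2 (μ : Measure ℝ))
    (hf : ∀ t, inner ℂ (expL2 μ t) f = 0) : f = 0 := by
  have hint : Integrable f (μ : Measure ℝ) := (Lp.memLp f).integrable (by norm_num)
  have h0 : ∀ t, ∫ x, ex (t * x) * f x ∂(μ : Measure ℝ) = 0 := by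
    intro t
    rw [← hf (-t), L2.inner_def]
    refine integral_congr_ae ?_
    filter_upwards [expL2_coeFn μ (-t)] with x hx
    rw [hx, RCLike.inner_apply, ← ex_neg]
    rw [mul_comm]; congr 2; ring
  have hmul : ∀ t (u : ℝ → ℂ), Integrable u (μ : Measure ℝ) →
      Integrable (fun x => ex (t * x) * u x) (μ : Measure ℝ) := fun t u hu =>
    hu.bdd_mul (c := 1) ((continuous_ex.comp (by fun_prop)).aestronglyMeasurable)
      (Eventually.of_forall fun x => (norm_ex _).le)
  have hintc : Integrable (fun x => (starRingEnd ℂ) (f x)) (μ : Measure ℝ) :=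
    (RCLike.conjLIE (K := ℂ)).integrable_comp_iff.2 hint
  -- The vanishing condition over all frequencies is invariant under conjugation, so it passes to
  -- the real and imaginary parts.
  have h0c : ∀ t, ∫ x, ex (t * x) * (starRingEnd ℂ) (f x) ∂(μ : Measure ℝ) = 0 := by
    intro t
    have h := congrArg (starRingEnd ℂ) (h0 (-t))
    rw [← integral_conj, map_zero] at h
    rw [← h]
    refine integral_congr_ae (Eventually.of_forall fun x => ?_)
    simp only [map_mul, ← ex_neg]
    congr 2; ring
  have hre : (fun x => (f x).re) =ᵐ[(μ : Measure ℝ)] 0 := by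
    refine ae_eq_zero_of_integral_ex _ hint.re fun t => ?_
    have h1 : ∀ x, ex (t * x) * (((f x).re : ℝ) : ℂ)
        = (1 / 2) * (ex (t * x) * f x + ex (t * x) * (starRingEnd ℂ) (f x)) := fun x => by
      rw [Complex.re_eq_add_conj]; ring
    simp only [h1]
    rw [integral_const_mul, integral_add (hmul t _ hint) (hmul t _ hintc), h0, h0c]
    simp
  have him : (fun x => (f x).im) =ᵐ[(μ : Measure ℝ)] 0 := by
    refine ae_eq_zero_of_integral_ex _ hint.im fun t => ?_
    have h1 : ∀ x, ex (t * x) * (((f x).im : ℝ) : ℂ)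
        = (1 / (2 * Complex.I)) * (ex (t * x) * f x - ex (t * x) * (starRingEnd ℂ) (f x)) :=
      fun x => by rw [Complex.im_eq_sub_conj]; ring
    simp only [h1]
    rw [integral_const_mul, integral_sub (hmul t _ hint) (hmul t _ hintc), h0, h0c]
    simp
  refine (Lp.eq_zero_iff_ae_eq_zero).2 ?_
  filter_upwards [hre, him] with x h1 h2
  exact Complex.ext h1 h2

/-- A vector for which Bessel's inequality is an equality lies in the closed span. -/
theorem mem_closure_span_of_hasSum {E ι : Type*} [NormedAddCommGroup E] [InnerProductSpace ℂ E]
    {v : ι → E} (hv : Orthonormal ℂ v) {x : E}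
    (hx : HasSum (fun i => ‖inner ℂ (v i) x‖ ^ 2) (‖x‖ ^ 2)) :
    x ∈ (Submodule.span ℂ (Set.range v)).topologicalClosure := by
  classical
  have hnorm : ∀ s : Finset ι, ‖x - ∑ i ∈ s, inner ℂ (v i) x • v i‖ ^ 2
      = ‖x‖ ^ 2 - ∑ i ∈ s, ‖inner ℂ (v i) x‖ ^ 2 := by
    intro s
    have h1 : inner ℂ x (∑ i ∈ s, inner ℂ (v i) x • v i)
        = ((∑ i ∈ s, ‖inner ℂ (v i) x‖ ^ 2 : ℝ) : ℂ) := by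
      rw [inner_sum]
      push_cast
      refine Finset.sum_congr rfl fun i _ => ?_
      rw [inner_smul_right, ← inner_conj_symm x (v i), RCLike.mul_conj]
      norm_cast
    have h2 : ‖∑ i ∈ s, inner ℂ (v i) x • v i‖ ^ 2 = ∑ i ∈ s, ‖inner ℂ (v i) x‖ ^ 2 := by
      rw [← inner_self_eq_norm_sq (𝕜 := ℂ), hv.inner_sum]
      rw [map_sum]
      refine Finset.sum_congr rfl fun i _ => ?_
      rw [RCLike.conj_mul]
      norm_cast
    rw [@norm_sub_sq ℂ, h1, h2]
    simp only [RCLike.re_eq_complex_re, Complex.ofReal_re]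
    ring
  have hlim : Tendsto (fun s : Finset ι => ∑ i ∈ s, inner ℂ (v i) x • v i) atTop (𝓝 x) := by
    rw [tendsto_iff_norm_sub_tendsto_zero]
    have h1 : Tendsto (fun s : Finset ι => ‖x‖ ^ 2 - ∑ i ∈ s, ‖inner ℂ (v i) x‖ ^ 2) atTop
        (𝓝 0) := by
      have := (tendsto_const_nhds (x := ‖x‖ ^ 2)).sub hx
      rwa [sub_self] at this
    have h2 := h1.sqrt
    rw [Real.sqrt_zero] at h2
    refine h2.congr fun s => ?_
    rw [← hnorm, Real.sqrt_sq (norm_nonneg _), norm_sub_rev]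
  refine mem_closure_of_tendsto hlim (Eventually.of_forall fun s => ?_)
  exact Submodule.sum_mem _ fun i _ =>
    Submodule.smul_mem _ _ (Submodule.subset_span (Set.mem_range_self i))

/-- A countable orthogonal family of exponentials satisfying Parseval's identity for all
exponentials is a spectrum. -/
theorem isSpectrum_range {ι : Type*} [Countable ι] (l : ι → ℝ)
    (ho : ∀ i j, i ≠ j → ft (μ : Measure ℝ) (l i - l j) = 0)
    (hs : ∀ ξ, HasSum (fun i => ‖ft (μ : Measure ℝ) (ξ + l i)‖ ^ 2) 1) :
    IsSpectrum μ (Set.range l) := by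
  have hv : Orthonormal ℂ fun i => expL2 μ (l i) :=
    ⟨fun i => norm_expL2 μ _, fun i j hij => by
      change inner ℂ (expL2 μ (l i)) (expL2 μ (l j)) = 0
      rw [inner_expL2]; exact ho j i hij.symm⟩
  refine ⟨Set.countable_range l, ?_, ?_⟩
  · rintro _ ⟨i, rfl⟩ _ ⟨j, rfl⟩ hij
    rw [inner_expL2]
    exact ho j i fun h => hij (by rw [h])
  · rw [← Set.range_comp]
    -- Equality in Bessel's inequality puts every exponential, not only those in the family, into
    -- the closed span; all exponentials together are total.
    have hmem : ∀ t, expL2 μ t ∈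
        (Submodule.span ℂ (Set.range fun i => expL2 μ (l i))).topologicalClosure := by
      intro t
      refine mem_closure_span_of_hasSum hv ?_
      rw [norm_expL2, one_pow]
      convert hs (-t) using 2 with i
      rw [inner_expL2, ← norm_ft_neg]
      congr 3; ring
    rw [Submodule.topologicalClosure_eq_top_iff, Submodule.eq_bot_iff]
    intro f hf
    refine eq_zero_of_inner_expL2 μ f fun t => ?_
    have h1 : f ∈ ((Submodule.span ℂ (Set.range fun i => expL2 μ (l i))).topologicalClosure)ᗮ := by
      rwa [Submodule.orthogonal_closure]
    exact h1 _ (hmem t)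

end L2

/-! ### Points far from the integers -/

/-- The distance of `x` to the integers is at least `1 / 18`. -/
def Far (x : ℝ) : Prop := ∀ n : ℤ, 1 / 18 ≤ |x - n|

theorem far_add_intCast (x : ℝ) (m : ℤ) : Far (x + m) ↔ Far x := by
  constructor
  · intro h n
    have := h (n + m)
    push_cast at this
    rwa [show x + m - (n + m) = x - n by ring] at this
  · intro h n
    have := h (n - m)
    push_cast at this
    rwa [show x - (n - m) = x + m - n by ring] at this

theorem not_far_iff (x : ℝ) : ¬ Far x ↔ |x - round x| < 1 / 18 := by
  rw [Far]
  push Not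
  constructor
  · rintro ⟨n, hn⟩
    exact (round_le x n).trans_lt hn
  · intro h
    exact ⟨_, h⟩

/-- With `y` the distance to the nearest integer, `|1 + e(y)|² = 2 + 2 cos 2πy ≤ 4 - 16 y²`, and `4
- 16/324 < 1.99²`. -/
theorem norm_one_add_ex_le {x : ℝ} (hx : Far x) : ‖1 + ex x‖ ≤ 199 / 100 := by
  set y := x - round x with hy
  have hxy : ex x = ex y := by
    rw [← ex_add_intCast y (round x), hy, sub_add_cancel]
  have h1 : 1 / 18 ≤ |y| := hx (round x)
  have h2 : |y| ≤ 1 / 2 := abs_sub_round x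
  have hpi := Real.pi_pos
  have hcos : Real.cos (2 * Real.pi * y) ≤ 1 - 8 * y ^ 2 := by
    have := Real.cos_le_one_sub_mul_cos_sq (x := 2 * Real.pi * y) (by
      rw [abs_mul, abs_of_pos Real.two_pi_pos]; nlinarith)
    refine this.trans (le_of_eq ?_)
    field_simp
    ring
  have hsq : ‖1 + ex y‖ ^ 2 = 2 + 2 * Real.cos (2 * Real.pi * y) := by
    rw [← Complex.normSq_eq_norm_sq, Complex.normSq_apply]
    simp only [Complex.add_re, Complex.one_re, Complex.add_im, Complex.one_im, ex_re, ex_im]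
    nlinarith [Real.sin_sq_add_cos_sq (2 * Real.pi * y)]
  have h3 : (1 / 18 : ℝ) ^ 2 ≤ y ^ 2 := by
    rw [← sq_abs y]; gcongr
  rw [hxy]
  refine abs_le_of_sq_le_sq' ?_ (by norm_num) |>.2
  rw [hsq]
  nlinarith

/-- The far phase is paired with the constant term and the other phase is bounded by `1`: `(1.99 +
1) / 3 = 299 / 300`. -/
theorem norm_mask_le_of_far {a b t : ℝ} (h : Far (t * a) ∨ Far (t * b)) :
    ‖mask a b t‖ ^ 2 ≤ (299 / 300) ^ 2 := by
  have key : ∀ z w : ℂ, ‖1 + z‖ ≤ 199 / 100 → ‖w‖ = 1 → ‖(1 + z + w) / 3‖ ≤ 299 / 300 := by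
    intro z w hz hw
    rw [norm_div, show ‖(3 : ℂ)‖ = 3 by simp, div_le_iff₀ (by norm_num)]
    refine (norm_add_le _ _).trans ?_
    rw [hw]
    linarith
  gcongr
  rcases h with h | h
  · exact key _ _ (norm_one_add_ex_le h) (norm_ex _)
  · rw [mask, add_right_comm]
    exact key _ _ (norm_one_add_ex_le h) (norm_ex _)

/-! ### The orbit `u, (4/9) u, (4/9)² u, …` modulo one -/

/-- The integer `9 round(4u/9) - 4 round u` has modulus below `9/18 + 4/18 < 1`. -/
theorem nine_mul_eq_of_not_far {u : ℝ} (h1 : ¬ Far u) (h2 : ¬ Far (u * (4 / 9))) :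
    9 * round (u * (4 / 9)) = 4 * round u := by
  rw [not_far_iff, abs_lt] at h1 h2
  have h3 : |((9 * round (u * (4 / 9)) - 4 * round u : ℤ) : ℝ)| < 1 := by
    push_cast
    rw [abs_lt]
    constructor <;> linarith [h1.1, h1.2, h2.1, h2.2]
  have h4 : |9 * round (u * (4 / 9)) - 4 * round u| < 1 := by exact_mod_cast h3
  rw [Int.abs_lt_one_iff] at h4
  linarith

theorem abs_nine_mul_sub_le (u : ℝ) :
    |9 * round (u * (4 / 9)) - 4 * round u| ≤ 6 := by
  have h1 := abs_le.1 (abs_sub_round u)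
  have h2 := abs_le.1 (abs_sub_round (u * (4 / 9)))
  have h3 : |((9 * round (u * (4 / 9)) - 4 * round u : ℤ) : ℝ)| < 7 := by
    push_cast
    rw [abs_lt]
    constructor <;> linarith [h1.1, h1.2, h2.1, h2.2]
  have h4 : |9 * round (u * (4 / 9)) - 4 * round u| < 7 := by exact_mod_cast h3
  omega

open Classical in
/-- A long run of near-integers in the orbit forces divisibility by a high power of `9`; hence
the orbit of `u` is far from the integers at least `log log |u|` times. -/
theorem exists_far_orbit (b : ℕ) (u : ℝ) (hu : (1600 : ℝ) ^ (2 ^ b) ≤ 1600 * |u|) :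
    ∃ N, b ≤ ((Finset.range N).filter fun i => Far (u * (4 / 9) ^ i)).card := by
  induction b generalizing u with
  | zero => exact ⟨0, by simp⟩
  | succ b ih =>
    have hu1 : 1600 ≤ |u| := by
      have : (1600 : ℝ) ^ 2 ≤ 1600 ^ (2 ^ (b + 1)) := by
        refine pow_le_pow_right₀ (by norm_num) ?_
        calc 2 = 2 ^ 1 := rfl
          _ ≤ 2 ^ (b + 1) := Nat.pow_le_pow_right (by norm_num) (by omega)
      nlinarith
    -- `J` is the least run length with `9 ^ J > 2 |u|`: too long for `9 ^ J` to divide the nonzero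
    -- integer `round u`, yet `9 ^ J ≤ 18 |u|`.
    obtain ⟨J0, hJ0, hJ0'⟩ := exists_nat_pow_near (x := 2 * |u|) (y := 9) (by linarith)
      (by norm_num)
    set J := J0 + 1 with hJ
    have hup : (9 : ℝ) ^ J ≤ 18 * |u| := by rw [hJ, pow_succ]; linarith
    have hfar : ∃ i ≤ J, Far (u * (4 / 9) ^ i) := by
      by_contra! hcon
      have hstep : ∀ i, i ≤ J → 9 ^ i * round (u * (4 / 9) ^ i) = 4 ^ i * round u := by
        intro i hi
        induction i with
        | zero => simp
        | succ i ihi =>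
          have h1 := nine_mul_eq_of_not_far (hcon i (by omega))
            (by rw [mul_assoc, ← pow_succ]; exact hcon (i + 1) hi)
          rw [mul_assoc, ← pow_succ] at h1
          have h2 := ihi (by omega)
          rw [pow_succ, mul_assoc, h1, pow_succ]
          linear_combination 4 * h2
      have hdvd : (9 : ℤ) ^ J ∣ round u := by
        have h1 : (9 : ℤ) ^ J ∣ 4 ^ J * round u := ⟨_, (hstep J le_rfl).symm⟩
        exact (IsCoprime.pow (by norm_num : IsCoprime (9 : ℤ) 4)).dvd_of_dvd_mul_left h1
      have hr := abs_le.1 (abs_sub_round u)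
      have hne : round u ≠ 0 := by
        intro h0
        rw [h0] at hr
        rcases le_abs.1 hu1 with h | h <;> norm_num at hr <;> linarith [hr.1, hr.2]
      have hle := Int.le_of_dvd (abs_pos.2 hne) ((dvd_abs _ _).2 hdvd)
      have hle' : (9 : ℝ) ^ J ≤ |(round u : ℝ)| := by exact_mod_cast hle
      have h5 : |(round u : ℝ)| ≤ |u| + 1 / 2 := by
        have := abs_sub_abs_le_abs_sub (round u : ℝ) u
        rw [abs_sub_comm] at this
        linarith [abs_sub_round u]
      linarith
    -- Since `(4/9)² ≥ 1/9` and `9 ^ (J + 1) ≤ 162 |u|`, the new point has modulus at least `√(|u| /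
    -- 162)`. Measured in units of `1/1600`, with `1600 ≥ 162`, the size drops at most to its square
    -- root, which halves the exponent `2 ^ (b + 1)`.
    have hu' : (1600 : ℝ) ^ (2 ^ b) ≤ 1600 * |u * (4 / 9) ^ (J + 1)| := by
      refine abs_le_of_sq_le_sq' ?_ (by positivity) |>.2
      rw [← pow_mul, ← pow_succ]
      refine hu.trans ?_
      rw [abs_mul, abs_of_pos (by positivity : (0 : ℝ) < (4 / 9) ^ (J + 1))]
      have h6 : (1 / 9 : ℝ) ^ (J + 1) ≤ ((4 / 9) ^ (J + 1)) ^ 2 := by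
        rw [← pow_mul, mul_comm, pow_mul]
        gcongr
        norm_num
      have h7 : 1 / (162 * |u|) ≤ (1 / 9 : ℝ) ^ (J + 1) := by
        rw [one_div_pow, pow_succ]
        apply one_div_le_one_div_of_le (by positivity)
        linarith
      have h8 : 1 / (162 * |u|) * (162 * |u|) = 1 := one_div_mul_cancel (by positivity)
      have h9 : (1600 * (|u| * (4 / 9) ^ (J + 1))) ^ 2
          = 1600 ^ 2 * |u| ^ 2 * ((4 / 9) ^ (J + 1)) ^ 2 := by ring
      rw [h9]
      calc 1600 * |u| = 1600 * |u| * (1 / (162 * |u|) * (162 * |u|)) := by rw [h8, mul_one]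
        _ = (1600 * 162) * |u| ^ 2 * (1 / (162 * |u|)) := by ring
        _ ≤ 1600 ^ 2 * |u| ^ 2 * ((4 / 9) ^ (J + 1)) ^ 2 := by
          gcongr
          · norm_num
          · exact h7.trans h6
    obtain ⟨N, hN⟩ := ih _ hu'
    refine ⟨J + 1 + N, ?_⟩
    obtain ⟨i, hi, hif⟩ := hfar
    have hsub : insert i (((Finset.range N).filter fun l =>
        Far (u * (4 / 9) ^ (J + 1) * (4 / 9) ^ l)).map (addLeftEmbedding (J + 1))) ⊆
        (Finset.range (J + 1 + N)).filter fun l => Far (u * (4 / 9) ^ l) := by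
      intro l hl
      rw [Finset.mem_insert] at hl
      rcases hl with rfl | hl
      · simp only [Finset.mem_filter, Finset.mem_range]
        exact ⟨by omega, hif⟩
      · simp only [Finset.mem_map, Finset.mem_filter, Finset.mem_range,
          addLeftEmbedding_apply] at hl ⊢
        obtain ⟨a, ⟨ha, hfa⟩, rfl⟩ := hl
        refine ⟨by omega, ?_⟩
        rwa [mul_assoc, ← pow_add] at hfa
    refine le_trans ?_ (Finset.card_le_card hsub)
    rw [Finset.card_insert_of_notMem, Finset.card_map]
    · omega
    · simp only [Finset.mem_map, addLeftEmbedding_apply, not_exists, not_and]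
      intro a _
      omega

/-- Integer sequences that obey `9 m (i + 1) = 4 m i` with at most `c` exceptions and small
errors and that end in `0` have few starting values. -/
theorem exists_finset_start (n c : ℕ) : ∃ S : Finset ℤ, S.card ≤ (12 * n + 1) ^ c ∧
    ∀ m : ℕ → ℤ, m n = 0 → (∀ i < n, |9 * m (i + 1) - 4 * m i| ≤ 6) →
      ((Finset.range n).filter fun i => 9 * m (i + 1) ≠ 4 * m i).card ≤ c → m 0 ∈ S := by
  induction n generalizing c with
  | zero => exact ⟨{0}, by simp, fun m hm _ _ => by simp [hm]⟩
  | succ n ih =>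
    have hcount : ∀ m : ℕ → ℤ,
        ((Finset.range (n + 1)).filter fun i => 9 * m (i + 1) ≠ 4 * m i).card
        = ((Finset.range n).filter fun i => 9 * m (i + 1 + 1) ≠ 4 * m (i + 1)).card
          + if 9 * m 1 ≠ 4 * m 0 then 1 else 0 := by
      intro m
      rw [Finset.card_filter, Finset.card_filter, Finset.sum_range_succ']
    have hstay : ∀ (S : Finset ℤ) (m : ℕ → ℤ), m 1 ∈ S → 9 * m 1 = 4 * m 0 →
        m 0 ∈ S.image fun x => 9 * x / 4 := by
      intro S m h1 h2
      refine Finset.mem_image.2 ⟨m 1, h1, ?_⟩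
      omega
    obtain ⟨S, hS, hSm⟩ := ih c
    cases c with
    | zero =>
      refine ⟨S.image fun x => 9 * x / 4, ?_, fun m hm hb hc => ?_⟩
      · exact Finset.card_image_le.trans (by simpa using hS)
      · rw [hcount] at hc
        have h0 : 9 * m 1 = 4 * m 0 := by
          by_contra h
          simp [h] at hc
        refine hstay S m (hSm (fun i => m (i + 1)) hm (fun i hi => hb (i + 1) (by omega)) ?_) h0
        omega
    | succ c =>
      obtain ⟨S', hS', hSm'⟩ := ih c
      -- The sequence is reconstructed backwards: `m 0 = (9 m 1 - e) / 4`, where either `e = 0` and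
      -- the budget `c + 1` is kept, or `e` is one of the `12` nonzero integers in `[-6, 6]` and one
      -- exception is spent.
      refine ⟨(S.image fun x => 9 * x / 4) ∪
        ((S' ×ˢ (Finset.Icc (-6) 6).erase 0).image fun x => (9 * x.1 - x.2) / 4), ?_, ?_⟩
      · refine (Finset.card_union_le _ _).trans ?_
        have h1 : (S.image fun x => 9 * x / 4).card ≤ (12 * n + 1) ^ (c + 1) :=
          Finset.card_image_le.trans hS
        have h2 : ((S' ×ˢ (Finset.Icc (-6 : ℤ) 6).erase 0).image
            fun x => (9 * x.1 - x.2) / 4).card ≤ (12 * n + 1) ^ c * 12 := by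
          refine Finset.card_image_le.trans ?_
          rw [Finset.card_product]
          exact Nat.mul_le_mul hS' (by decide)
        calc _ ≤ (12 * n + 1) ^ (c + 1) + (12 * n + 1) ^ c * 12 := Nat.add_le_add h1 h2
          _ = (12 * n + 1) ^ c * (12 * (n + 1) + 1) := by ring
          _ ≤ (12 * (n + 1) + 1) ^ c * (12 * (n + 1) + 1) := by gcongr; omega
          _ = _ := by ring
      · intro m hm hb hc
        rw [hcount] at hc
        by_cases h0 : 9 * m 1 = 4 * m 0
        · refine Finset.mem_union_left _ (hstay S m
            (hSm (fun i => m (i + 1)) hm (fun i hi => hb (i + 1) (by omega)) ?_) h0)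
          omega
        · refine Finset.mem_union_right _ (Finset.mem_image.2 ⟨(m 1, 9 * m 1 - 4 * m 0), ?_, ?_⟩)
          · refine Finset.mem_product.2 ⟨hSm' (fun i => m (i + 1)) hm
              (fun i hi => hb (i + 1) (by omega)) ?_, ?_⟩
            · simp only [ne_eq, h0, not_false_eq_true, if_true] at hc
              simp only [ne_eq]
              omega
            · have := abs_le.1 (hb 0 (by omega))
              simp only [Finset.mem_erase, Finset.mem_Icc]
              simp only [zero_add] at this
              omega
          · simp only
            omega

/-! ### Layers of frequencies for `p = 9`, `D_n = {0, 2, 4^n}` -/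

/-- The mask of level `k` for the digits `{0, 2, 4^k}` and the base `9`. -/
def maskA (k : ℕ) (t : ℝ) : ℂ := mask (2 / 9 ^ k) ((4 / 9) ^ k) t

theorem maskA_eq_zero {k : ℕ} {t : ℝ} (h : maskA k t = 0) :
    ∃ j : ℤ, ¬ (3 : ℤ) ∣ j ∧ t = 9 ^ k * j / 6 := by
  obtain ⟨j, hj, h⟩ := mask_eq_zero h
  refine ⟨j, hj, ?_⟩
  field_simp at h
  linarith

theorem le_abs_of_maskA_eq_zero {k : ℕ} {t : ℝ} (h : maskA k t = 0) : 9 ^ k / 6 ≤ |t| := by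
  obtain ⟨j, hj, rfl⟩ := maskA_eq_zero h
  have h1 : (1 : ℤ) ≤ |j| := Int.one_le_abs (by rintro rfl; simp at hj)
  have h2 : (1 : ℝ) ≤ |(j : ℝ)| := by exact_mod_cast h1
  rw [abs_div, abs_mul, abs_of_pos (by positivity : (0 : ℝ) < 9 ^ k), abs_of_pos (by norm_num :
    (0 : ℝ) < 6)]
  have : (0 : ℝ) < 9 ^ k := by positivity
  rw [div_le_div_iff_of_pos_right (by norm_num)]
  nlinarith

theorem norm_maskA_sq_le_one (k : ℕ) (t : ℝ) : ‖maskA k t‖ ^ 2 ≤ 1 :=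
  pow_le_one₀ (norm_nonneg _) (norm_mask_le _ _ _)

/-- The squared Fourier transform of the finite convolution of level `K`. -/
def weightA (K : ℕ) (t : ℝ) : ℝ := ∏ k ∈ Finset.Icc 1 K, ‖maskA k t‖ ^ 2

theorem weightA_nonneg (K : ℕ) (t : ℝ) : 0 ≤ weightA K t :=
  Finset.prod_nonneg fun _ _ => by positivity

/-- The constant by which a mask is bounded at points far from the integers. -/
def rho : ℝ := (299 / 300) ^ 2

theorem rho_pos : 0 < rho := by unfold rho; positivity

theorem rho_le_one : rho ≤ 1 := by unfold rho; norm_num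

theorem norm_maskA_le_of_far {k : ℕ} {t : ℝ}
    (h : Far (t * (2 / 9 ^ k)) ∨ Far (t * (4 / 9) ^ k)) : ‖maskA k t‖ ^ 2 ≤ rho :=
  norm_mask_le_of_far h

theorem weightA_le_mul_pow {K n : ℕ} (hKn : K ≤ n) {B : Finset ℕ} (hB : B ⊆ Finset.Ioc K n)
    {t : ℝ} (hfar : ∀ k ∈ B, Far (t * (2 / 9 ^ k)) ∨ Far (t * (4 / 9) ^ k)) :
    weightA n t ≤ weightA K t * rho ^ B.card := by
  have hsub : Finset.Icc 1 K ⊆ Finset.Icc 1 n := Finset.Icc_subset_Icc_right hKn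
  rw [weightA, ← Finset.prod_sdiff hsub, mul_comm]
  refine mul_le_mul_of_nonneg_left ?_ (weightA_nonneg K t)
  have hB' : B ⊆ Finset.Icc 1 n \ Finset.Icc 1 K := by
    intro k hk
    have := hB hk
    simp only [Finset.mem_Ioc, Finset.mem_sdiff, Finset.mem_Icc] at this ⊢
    omega
  rw [← Finset.prod_sdiff hB']
  refine (mul_le_of_le_one_left (Finset.prod_nonneg fun _ _ => by positivity)
    (Finset.prod_le_one (fun _ _ => by positivity) fun _ _ => norm_maskA_sq_le_one _ _)).trans ?_
  rw [← Finset.prod_const]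
  exact Finset.prod_le_prod (fun _ _ => by positivity) fun k hk => norm_maskA_le_of_far (hfar k hk)

/-- `t` lies in the layer `K`. -/
def InLayer (K : ℕ) (t : ℝ) : Prop := 9 ^ K / 36 < |t| ∧ |t| ≤ 9 ^ K / 4

/-- The layer is cut so that `2 |t| / 9 ^ K` lies in `(1/18, 1/2]`; it is thus away from `0` and
from every other integer. -/
theorem InLayer.far {K : ℕ} {t : ℝ} (h : InLayer K t) : Far (t * (2 / 9 ^ K)) := by
  have hK : (0 : ℝ) < 9 ^ K := by positivity
  have h0 : |t * (2 / 9 ^ K)| = 2 * |t| / 9 ^ K := by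
    rw [abs_mul, abs_of_pos (by positivity : (0 : ℝ) < 2 / 9 ^ K)]; ring
  have h1 : 1 / 18 < |t * (2 / 9 ^ K)| := by
    rw [h0, lt_div_iff₀ hK]; linarith [h.1]
  have h2 : |t * (2 / 9 ^ K)| ≤ 1 / 2 := by
    rw [h0, div_le_iff₀ hK]; linarith [h.2]
  intro n
  rcases eq_or_ne n 0 with rfl | hn
  · simpa using h1.le
  · have h3 : (1 : ℝ) ≤ |(n : ℝ)| := by exact_mod_cast Int.one_le_abs hn
    have h4 := abs_sub_abs_le_abs_sub (n : ℝ) (t * (2 / 9 ^ K))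
    rw [abs_sub_comm] at h4
    linarith

theorem nine_pow_lt {a b : ℕ} {c : ℝ} (h : (9 : ℝ) ^ a / 6 ≤ c) (hc : c < 9 ^ (b + 1) / 6) :
    a ≤ b := by
  have h1 : (9 : ℝ) ^ a < 9 ^ (b + 1) := by linarith
  have := (pow_lt_pow_iff_right₀ (by norm_num : (1 : ℝ) < 9)).1 h1
  omega

/-- Two points of the layer differ by at most `9 ^ K / 2`, and a zero of the mask of level `k` has
modulus at least `9 ^ k / 6`. -/
theorem InLayer.level_le {K k : ℕ} {t s : ℝ} (ht : InLayer K t) (hs : InLayer K s)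
    (hz : maskA k (s - t) = 0) : k ≤ K := by
  refine nine_pow_lt (le_abs_of_maskA_eq_zero hz) ?_
  have h1 : |s - t| ≤ |s| + |t| := abs_sub _ _
  rw [pow_succ]
  have : (0 : ℝ) < 9 ^ K := by positivity
  linarith [ht.2, hs.2]

open Classical in
/-- The number of levels in `(X, K]` at which `2 t / 9^i` is far from the integers. -/
def farCount (X K : ℕ) (t : ℝ) : ℕ :=
  ((Finset.Ioc X K).filter fun i => Far (t * (2 / 9 ^ i))).card

/-- If `s - t` is a zero of a mask of level `k > K`, then `2 (s - t) / 9 ^ i` is an integer for all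
`i ≤ K`. So `s` inherits all far levels of `t` and gains its own layer `K'`. Consequently
frequencies with equal counts are already orthogonal at a level not exceeding either layer. -/
theorem farCount_lt {X K K' k : ℕ} {t s : ℝ} (hXK : X ≤ K) (hK : K < K') (hk : K < k)
    (hs : InLayer K' s) (hz : maskA k (s - t) = 0) : farCount X K t < farCount X K' s := by
  classical
  obtain ⟨j, -, hj⟩ := maskA_eq_zero hz
  refine Finset.card_lt_card ?_
  rw [Finset.ssubset_iff_of_subset]
  · refine ⟨K', ?_, ?_⟩
    · simp only [Finset.mem_filter, Finset.mem_Ioc]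
      exact ⟨by omega, hs.far⟩
    · simp only [Finset.mem_filter, Finset.mem_Ioc]
      omega
  · intro i hi
    simp only [Finset.mem_filter, Finset.mem_Ioc] at hi ⊢
    refine ⟨by omega, ?_⟩
    have h1 : s * (2 / 9 ^ i) = t * (2 / 9 ^ i) + ((3 * 9 ^ (k - i - 1) * j : ℤ) : ℝ) := by
      have h2 : (9 : ℝ) ^ k = 9 ^ (k - i - 1) * 9 ^ i * 9 := by
        rw [← pow_add, ← pow_succ]; congr 1; omega
      have h3 : s = t + 9 ^ k * j / 6 := by linarith
      rw [h3, h2]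
      push_cast
      field_simp
      ring
    rw [h1, far_add_intCast]
    exact hi.2

/-- A set of frequencies whose exponentials are orthogonal. -/
def OrthoA (T : Finset ℝ) : Prop :=
  ∀ t ∈ T, ∀ s ∈ T, t ≠ s → ∃ k, 1 ≤ k ∧ maskA k (s - t) = 0

theorem OrthoA.subset {T T' : Finset ℝ} (h : OrthoA T) (hT : T' ⊆ T) : OrthoA T' :=
  fun t ht s hs hts => h t (hT ht) s (hT hs) hts

theorem sum_weightA_le_one (T : Finset ℝ) (K : ℝ → ℕ)
    (hT : ∀ t ∈ T, ∀ s ∈ T, t ≠ s → ∃ k, 1 ≤ k ∧ k ≤ K t ∧ k ≤ K s ∧ maskA k (s - t) = 0) :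
    ∑ t ∈ T, weightA (K t) t ≤ 1 :=
  sum_prod_mask_le_one (α := fun k => 2 / 9 ^ k) (β := fun k => (4 / 9) ^ k) T K hT

/-- Frequencies with the same number of far levels form an antichain. -/
theorem sum_weightA_farCount {T : Finset ℝ} (hT : OrthoA T) {X d : ℕ} {lay : ℝ → ℕ}
    (hlay : ∀ t ∈ T, InLayer (lay t) t) (hX : ∀ t ∈ T, X < lay t)
    (hd : ∀ t ∈ T, farCount X (lay t) t = d) : ∑ t ∈ T, weightA (lay t) t ≤ 1 := by
  refine sum_weightA_le_one T lay fun t ht s hs hts => ?_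
  obtain ⟨k, hk, hz⟩ := hT t ht s hs hts
  refine ⟨k, hk, ?_⟩
  have hz' : maskA k (t - s) = 0 := by
    rw [← neg_sub, maskA, mask_neg, ← maskA, hz, map_zero]
  rcases lt_trichotomy (lay t) (lay s) with h | h | h
  · have : k ≤ lay t := by
      by_contra hcon
      have := farCount_lt (hX t ht).le h (by omega) (hlay s hs) hz
      rw [hd t ht, hd s hs] at this
      omega
    exact ⟨this, by omega, hz⟩
  · have := InLayer.level_le (hlay t ht) (h ▸ hlay s hs) hz
    exact ⟨this, by omega, hz⟩
  · have : k ≤ lay s := by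
      by_contra hcon
      have := farCount_lt (hX s hs).le h (by omega) (hlay t ht) hz'
      rw [hd t ht, hd s hs] at this
      omega
    exact ⟨by omega, this, hz⟩

theorem sum_weightA_layer {T : Finset ℝ} (hT : OrthoA T) {K : ℕ}
    (hlay : ∀ t ∈ T, InLayer K t) : ∑ t ∈ T, weightA K t ≤ 1 := by
  refine sum_weightA_le_one T (fun _ => K) fun t ht s hs hts => ?_
  obtain ⟨k, hk, hz⟩ := hT t ht s hs hts
  have := InLayer.level_le (hlay t ht) (hlay s hs) hz
  exact ⟨k, hk, this, this, hz⟩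

/-- In a high layer every value of the Fourier transform is small compared with the weight. -/
theorem exists_weightA_le_of_layer {K b : ℕ} (hb : 6 * 2 ^ b ≤ K) {t : ℝ} (ht : InLayer K t) :
    ∃ n, weightA n t ≤ weightA K t * rho ^ b := by
  classical
  -- The phase at level `K + 1` has modulus at least `4 ^ K / 81`, and `1600 ≤ 4 ^ 6` explains the
  -- `6` in the hypothesis.
  have hu : (1600 : ℝ) ^ (2 ^ b) ≤ 1600 * |t * (4 / 9) ^ (K + 1)| := by
    have h1 : (1600 : ℝ) ^ (2 ^ b) ≤ 4 ^ K := by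
      calc (1600 : ℝ) ^ (2 ^ b) ≤ (4 ^ 6) ^ (2 ^ b) := by gcongr; norm_num
        _ = 4 ^ (6 * 2 ^ b) := by rw [← pow_mul]
        _ ≤ 4 ^ K := pow_le_pow_right₀ (by norm_num) hb
    rw [abs_mul, abs_of_pos (by positivity : (0 : ℝ) < (4 / 9) ^ (K + 1))]
    have h2 : (4 : ℝ) ^ K / 81 ≤ |t| * (4 / 9) ^ (K + 1) := by
      have h3 : (4 : ℝ) ^ K / 81 = 9 ^ K / 36 * (4 / 9) ^ (K + 1) := by
        rw [pow_succ, div_pow]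
        field_simp
        norm_num
      rw [h3]
      gcongr
      exact ht.1.le
    have h4 : (0 : ℝ) < 4 ^ K := by positivity
    linarith
  obtain ⟨N, hN⟩ := exists_far_orbit b _ hu
  refine ⟨K + N, ?_⟩
  set B := ((Finset.range N).filter fun i => Far (t * (4 / 9) ^ (K + 1) * (4 / 9) ^ i)).map
    (addLeftEmbedding (K + 1)) with hB
  have h1 := weightA_le_mul_pow (t := t) (Nat.le_add_right K N) (B := B) (by
    intro k hk
    simp only [hB, Finset.mem_map, Finset.mem_filter, Finset.mem_range, addLeftEmbedding_apply,
      Finset.mem_Ioc] at hk ⊢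
    omega) (by
    intro k hk
    simp only [hB, Finset.mem_map, Finset.mem_filter, Finset.mem_range,
      addLeftEmbedding_apply] at hk
    obtain ⟨a, ⟨-, ha⟩, rfl⟩ := hk
    rw [mul_assoc, ← pow_add] at ha
    exact Or.inr ha)
  refine h1.trans (mul_le_mul_of_nonneg_left ?_ (weightA_nonneg _ _))
  refine pow_le_pow_of_le_one rho_pos.le rho_le_one ?_
  rwa [hB, Finset.card_map]

open Classical in
/-- The number of levels in `(K, 3 K]` at which `(4 / 9)^i t` is far from the integers. -/
def sailCount (K : ℕ) (t : ℝ) : ℕ :=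
  ((Finset.Ioc K (3 * K)).filter fun i => Far (t * (4 / 9) ^ i)).card

theorem weightA_le_sailCount (K : ℕ) (t : ℝ) :
    weightA (3 * K) t ≤ weightA K t * rho ^ sailCount K t := by
  classical
  refine weightA_le_mul_pow (by omega) (Finset.filter_subset _ _) fun k hk => ?_
  exact Or.inr (Finset.mem_filter.1 hk).2

theorem weightA_le_farCount {X K : ℕ} (hXK : X ≤ K) (t : ℝ) :
    weightA K t ≤ weightA X t * rho ^ farCount X K t := by
  classical
  refine weightA_le_mul_pow hXK (Finset.filter_subset _ _) fun k hk => ?_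
  exact Or.inl (Finset.mem_filter.1 hk).2

/-- In a layer the points with few far levels lie in few intervals. -/
theorem exists_finset_round {K : ℕ} (hK : 1 ≤ K) (b : ℕ) :
    ∃ S : Finset ℤ, S.card ≤ (24 * K) ^ (2 * b) ∧ ∀ t, InLayer K t → sailCount K t ≤ b →
      round (t * (4 / 9) ^ (K + 1)) ∈ S := by
  classical
  obtain ⟨S, hS, hSm⟩ := exists_finset_start (2 * K - 1) (2 * b)
  refine ⟨S, hS.trans (Nat.pow_le_pow_left (by omega) _), fun t ht hb => ?_⟩
  set u : ℕ → ℝ := fun i => t * (4 / 9) ^ (K + 1 + i) with hu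
  have hu1 : ∀ i, u (i + 1) = u i * (4 / 9) := fun i => by
    simp only [hu]; rw [mul_assoc, ← pow_succ]; rfl
  have h0 : round (t * (4 / 9) ^ (K + 1)) = round (u 0) := by simp [hu]
  rw [h0]
  refine hSm (fun i => round (u i)) ?_ ?_ ?_
  -- By level `3K` the phase has died out, as `9 (4/9)³ = 64/81 < 1`; hence the rounded orbit ends
  -- in `0`.
  · rw [round_eq_zero_iff]
    have h1 : |u (2 * K - 1)| < 1 / 2 := by
      simp only [hu]
      rw [show K + 1 + (2 * K - 1) = 3 * K by omega, abs_mul,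
        abs_of_pos (by positivity : (0 : ℝ) < (4 / 9) ^ (3 * K))]
      calc |t| * (4 / 9) ^ (3 * K) ≤ 9 ^ K / 4 * (4 / 9) ^ (3 * K) := by gcongr; exact ht.2
        _ = (64 / 81) ^ K / 4 := by
          rw [pow_mul, div_mul_eq_mul_div, ← mul_pow]; norm_num
        _ ≤ 1 / 4 := by
          gcongr
          exact pow_le_one₀ (by norm_num) (by norm_num)
        _ < 1 / 2 := by norm_num
    rw [abs_lt] at h1
    exact ⟨h1.1.le, h1.2⟩
  · intro i _
    simp only [hu1]
    exact abs_nine_mul_sub_le _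
  · set A := (Finset.Ioc K (3 * K)).filter fun i => Far (t * (4 / 9) ^ i) with hA
    have hAb : A.card ≤ b := hb
    -- A violation of `9 m (i + 1) = 4 m i` needs a far point at `i` or at `i + 1`, so each far
    -- level accounts for at most two violations.
    have hsub : ((Finset.range (2 * K - 1)).filter fun i => 9 * round (u (i + 1)) ≠ 4 * round (u i))
        ⊆ A.image (fun k => k - (K + 1)) ∪ A.image (fun k => k - (K + 2)) := by
      intro i hi
      simp only [Finset.mem_filter, Finset.mem_range] at hi
      have hor : Far (u i) ∨ Far (u (i + 1)) := by
        by_contra! hcon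
        refine hi.2 ?_
        rw [hu1] at hcon ⊢
        exact nine_mul_eq_of_not_far hcon.1 hcon.2
      rw [Finset.mem_union, Finset.mem_image, Finset.mem_image]
      rcases hor with h | h
      · refine Or.inl ⟨K + 1 + i, ?_, by omega⟩
        rw [hA, Finset.mem_filter, Finset.mem_Ioc]
        exact ⟨by omega, h⟩
      · refine Or.inr ⟨K + 1 + (i + 1), ?_, by omega⟩
        rw [hA, Finset.mem_filter, Finset.mem_Ioc]
        exact ⟨by omega, h⟩
    refine (Finset.card_le_card hsub).trans ((Finset.card_union_le _ _).trans ?_)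
    have h1 := Finset.card_image_le (s := A) (f := fun k => k - (K + 1))
    have h2 := Finset.card_image_le (s := A) (f := fun k => k - (K + 2))
    omega

/-- Equal roundings give `|s - t| ≤ (9/4)^(K+1)`. Because `K ≤ 2 X` and `(9/4)² < 9`, this is below
`9 ^ (X + 1) / 6`, so orthogonality occurs at a level at most `X`. This is what limits a block of
layers to `(X, 2X]`. -/
theorem sum_weightA_round {T : Finset ℝ} (hT : OrthoA T) {X K : ℕ} (hX : 1 ≤ X)
    (hK : K ≤ 2 * X) {m : ℤ} (hm : ∀ t ∈ T, round (t * (4 / 9) ^ (K + 1)) = m) :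
    ∑ t ∈ T, weightA X t ≤ 1 := by
  refine sum_weightA_le_one T (fun _ => X) fun t ht s hs hts => ?_
  obtain ⟨k, hk, hz⟩ := hT t ht s hs hts
  have hle : k ≤ X := by
    refine nine_pow_lt (le_abs_of_maskA_eq_zero hz) ?_
    have h1 : |s * (4 / 9) ^ (K + 1) - t * (4 / 9) ^ (K + 1)| ≤ 1 := by
      have h2 := abs_le.1 (abs_sub_round (s * (4 / 9) ^ (K + 1)))
      have h3 := abs_le.1 (abs_sub_round (t * (4 / 9) ^ (K + 1)))
      rw [hm s hs] at h2
      rw [hm t ht] at h3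
      rw [abs_le]
      constructor <;> linarith [h2.1, h2.2, h3.1, h3.2]
    rw [← sub_mul, abs_mul, abs_of_pos (by positivity : (0 : ℝ) < (4 / 9) ^ (K + 1))] at h1
    have h4 : |s - t| ≤ (9 / 4) ^ (K + 1) := by
      have h5 : ((4 : ℝ) / 9) ^ (K + 1) * (9 / 4) ^ (K + 1) = 1 := by
        rw [← mul_pow]; norm_num
      have h6 : (0 : ℝ) < (9 / 4) ^ (K + 1) := by positivity
      calc |s - t| = |s - t| * (4 / 9) ^ (K + 1) * (9 / 4) ^ (K + 1) := by
            rw [mul_assoc, h5, mul_one]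
        _ ≤ 1 * (9 / 4) ^ (K + 1) := by gcongr
        _ = _ := one_mul _
    refine h4.trans_lt ?_
    calc ((9 : ℝ) / 4) ^ (K + 1) ≤ (9 / 4) ^ (2 * X + 1) :=
          pow_le_pow_right₀ (by norm_num) (by omega)
      _ = (81 / 16) ^ X * (9 / 4) := by rw [pow_succ, pow_mul]; norm_num
      _ < 9 ^ X * (3 / 2) := by
          obtain ⟨Y, rfl⟩ : ∃ Y, X = Y + 1 := ⟨X - 1, by omega⟩
          have h7 : ((81 : ℝ) / 16) ^ Y ≤ 9 ^ Y := by gcongr; norm_num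
          have h8 : (0 : ℝ) < 9 ^ Y := by positivity
          rw [pow_succ, pow_succ]
          nlinarith
      _ = 9 ^ (X + 1) / 6 := by rw [pow_succ]; ring
  exact ⟨k, hk, hle, hle, hz⟩

/-! ### The contribution of a dyadic range of layers -/

theorem sum_le_card_mul_of_fibers {ι κ : Type*} [DecidableEq κ] {T : Finset ι} {S : Finset κ}
    {g : ι → κ} (hg : ∀ t ∈ T, g t ∈ S) {f : ι → ℝ} {c : ℝ}
    (h : ∀ k ∈ S, ∑ t ∈ T.filter (fun t => g t = k), f t ≤ c) :
    ∑ t ∈ T, f t ≤ S.card * c := by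
  rw [← Finset.sum_fiberwise_of_maps_to hg]
  exact (Finset.sum_le_card_nsmul _ _ _ h).trans (by rw [nsmul_eq_mul])

/-- The guaranteed loss `rho ^ b₀` cannot pay for all `X` layers, but it can pay for `J` antichains,
which contain every frequency with fewer than `J` far levels in `(X, lay t]`. Frequencies with at
least `b` losses after their layer can afford the factor `X`. The remaining ones have suffered `J`
losses between `X` and their layer, and in each layer they lie in at most `(48 X) ^ (2 b)`
intervals, on each of which Bessel's inequality holds at level `X`. The three classes use `hF` with
different `n`. -/
theorem sum_dyadic_le {T : Finset ℝ} (hT : OrthoA T) {F : ℝ → ℝ}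
    (hF : ∀ t n, F t ≤ weightA n t) {X b₀ b J : ℕ} (hX : 1 ≤ X) (hb₀ : 6 * 2 ^ b₀ ≤ X)
    {lay : ℝ → ℕ} (hlay : ∀ t ∈ T, InLayer (lay t) t) (hXl : ∀ t ∈ T, lay t ∈ Finset.Ioc X (2 * X)) :
    ∑ t ∈ T, F t ≤ J * rho ^ b₀ + X * rho ^ b + X * ((48 * X) ^ (2 * b) * rho ^ J) := by
  classical
  have hX1 : ∀ t ∈ T, X < lay t ∧ lay t ≤ 2 * X := fun t ht => Finset.mem_Ioc.1 (hXl t ht)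
  have hcard : (Finset.Ioc X (2 * X)).card = X := by rw [Nat.card_Ioc]; omega
  -- few far levels among the digits
  set T₁ := T.filter fun t => farCount X (lay t) t < J
  set T' := T.filter fun t => ¬ farCount X (lay t) t < J
  set T₂ := T'.filter fun t => b ≤ sailCount (lay t) t
  set T₃ := T'.filter fun t => ¬ b ≤ sailCount (lay t) t
  have hT₁ : T₁ ⊆ T := Finset.filter_subset _ _
  have hT' : T' ⊆ T := Finset.filter_subset _ _
  have hT₂ : T₂ ⊆ T := (Finset.filter_subset _ _).trans hT'
  have hT₃ : T₃ ⊆ T := (Finset.filter_subset _ _).trans hT'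
  have hsplit : ∑ t ∈ T, F t = ∑ t ∈ T₁, F t + ∑ t ∈ T₂, F t + ∑ t ∈ T₃, F t := by
    rw [add_assoc, Finset.sum_filter_add_sum_filter_not, Finset.sum_filter_add_sum_filter_not]
  have e1 : ∑ t ∈ T₁, F t ≤ J * rho ^ b₀ := by
    have := sum_le_card_mul_of_fibers (T := T₁) (S := Finset.range J)
      (g := fun t => farCount X (lay t) t) (f := F) (c := rho ^ b₀)
      (fun t ht => Finset.mem_range.2 (Finset.mem_filter.1 ht).2) (fun d _ => ?_)
    · rwa [Finset.card_range] at this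
    · set U := T₁.filter fun t => farCount X (lay t) t = d
      have hU : U ⊆ T := (Finset.filter_subset _ _).trans hT₁
      have hsum := sum_weightA_farCount (hT.subset hU) (X := X) (d := d)
        (fun t ht => hlay t (hU ht)) (fun t ht => (hX1 t (hU ht)).1)
        (fun t ht => (Finset.mem_filter.1 ht).2)
      calc ∑ t ∈ U, F t ≤ ∑ t ∈ U, weightA (lay t) t * rho ^ b₀ := by
            refine Finset.sum_le_sum fun t ht => ?_
            obtain ⟨n, hn⟩ := exists_weightA_le_of_layer
              (hb₀.trans (hX1 t (hU ht)).1.le) (hlay t (hU ht))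
            exact (hF t n).trans hn
        _ ≤ 1 * rho ^ b₀ := by
            rw [← Finset.sum_mul]
            exact mul_le_mul_of_nonneg_right hsum (pow_pos rho_pos _).le
        _ = rho ^ b₀ := one_mul _
  -- many far levels after the layer
  have e2 : ∑ t ∈ T₂, F t ≤ X * rho ^ b := by
    have := sum_le_card_mul_of_fibers (T := T₂) (S := Finset.Ioc X (2 * X))
      (g := lay) (f := F) (c := rho ^ b) (fun t ht => hXl t (hT₂ ht)) (fun K _ => ?_)
    · rwa [hcard] at this
    · set U := T₂.filter fun t => lay t = K
      have hU : U ⊆ T := (Finset.filter_subset _ _).trans hT₂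
      have hUK : ∀ t ∈ U, lay t = K := fun t ht => (Finset.mem_filter.1 ht).2
      have hsum := sum_weightA_layer (hT.subset hU) (K := K)
        (fun t ht => hUK t ht ▸ hlay t (hU ht))
      calc ∑ t ∈ U, F t ≤ ∑ t ∈ U, weightA K t * rho ^ b := by
            refine Finset.sum_le_sum fun t ht => ?_
            refine (hF t (3 * K)).trans ((weightA_le_sailCount K t).trans ?_)
            refine mul_le_mul_of_nonneg_left ?_ (weightA_nonneg _ _)
            refine pow_le_pow_of_le_one rho_pos.le rho_le_one ?_
            have := (Finset.mem_filter.1 (Finset.mem_filter.1 ht).1).2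
            rwa [hUK t ht] at this
        _ ≤ 1 * rho ^ b := by
            rw [← Finset.sum_mul]
            exact mul_le_mul_of_nonneg_right hsum (pow_pos rho_pos _).le
        _ = rho ^ b := one_mul _
  -- few exceptional intervals
  have e3 : ∑ t ∈ T₃, F t ≤ X * ((48 * X) ^ (2 * b) * rho ^ J) := by
    have := sum_le_card_mul_of_fibers (T := T₃) (S := Finset.Ioc X (2 * X))
      (g := lay) (f := F) (c := (48 * X) ^ (2 * b) * rho ^ J)
      (fun t ht => hXl t (hT₃ ht)) (fun K hK => ?_)
    · rwa [hcard] at this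
    · set U := T₃.filter fun t => lay t = K
      have hU : U ⊆ T := (Finset.filter_subset _ _).trans hT₃
      have hUK : ∀ t ∈ U, lay t = K := fun t ht => (Finset.mem_filter.1 ht).2
      rw [Finset.mem_Ioc] at hK
      obtain ⟨S, hS, hSm⟩ := exists_finset_round (by omega : 1 ≤ K) b
      have h1 := sum_le_card_mul_of_fibers (T := U) (S := S)
        (g := fun t => round (t * (4 / 9) ^ (K + 1))) (f := F) (c := rho ^ J)
        (fun t ht => by
          refine hSm t (hUK t ht ▸ hlay t (hU ht)) ?_
          have := (Finset.mem_filter.1 (Finset.mem_filter.1 ht).1).2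
          rw [hUK t ht] at this
          omega)
        (fun m _ => by
          set V := U.filter fun t => round (t * (4 / 9) ^ (K + 1)) = m
          have hV : V ⊆ U := Finset.filter_subset _ _
          have hsum := sum_weightA_round (hT.subset (hV.trans hU)) hX hK.2 (m := m)
            (fun t ht => (Finset.mem_filter.1 ht).2)
          calc ∑ t ∈ V, F t ≤ ∑ t ∈ V, weightA X t * rho ^ J := by
                refine Finset.sum_le_sum fun t ht => ?_
                refine (hF t K).trans ((weightA_le_farCount hK.1.le t).trans ?_)
                refine mul_le_mul_of_nonneg_left ?_ (weightA_nonneg _ _)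
                refine pow_le_pow_of_le_one rho_pos.le rho_le_one ?_
                have := (Finset.mem_filter.1 (Finset.mem_filter.1
                  (Finset.mem_filter.1 (hV ht)).1).1).2
                rw [hUK t (hV ht)] at this
                omega
            _ ≤ 1 * rho ^ J := by
                rw [← Finset.sum_mul]
                exact mul_le_mul_of_nonneg_right hsum (pow_pos rho_pos _).le
            _ = rho ^ J := one_mul _)
      refine h1.trans (mul_le_mul_of_nonneg_right ?_ (pow_pos rho_pos _).le)
      calc (S.card : ℝ) ≤ ((24 * K) ^ (2 * b) : ℕ) := by exact_mod_cast hS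
        _ ≤ ((48 * X) ^ (2 * b) : ℕ) := by
            exact_mod_cast Nat.pow_le_pow_left (by omega) _
        _ = _ := by push_cast; rfl
  rw [hsplit]
  linarith

theorem rho_pow_le : rho ^ 300 ≤ 1 / 4 := by
  have h1 : rho ^ 300 = (299 / 300 : ℝ) ^ 600 := by rw [rho, ← pow_mul]
  have h2 : (299 / 300 : ℝ) ^ 600 ≤ Real.exp (-(1 / 300)) ^ 600 := by
    gcongr
    have := Real.add_one_le_exp (-(1 / 300))
    linarith
  rw [h1]
  refine h2.trans ?_
  rw [← Real.exp_nat_mul]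
  have h3 : ((600 : ℕ) : ℝ) * -(1 / 300) = -(1 + 1) := by norm_num
  rw [h3, Real.exp_neg, Real.exp_add]
  have h4 : (2 : ℝ) ≤ Real.exp 1 := by
    have := Real.add_one_le_exp (1 : ℝ)
    linarith
  rw [one_div]
  apply inv_anti₀ (by norm_num)
  nlinarith

/-- Lets `300` losses count as a factor `1/4`, which makes the exponents below integers. -/
theorem rho_pow_mul_le (q : ℕ) : rho ^ (300 * q) ≤ (1 / 2) ^ (2 * q) := by
  rw [pow_mul, pow_mul]
  have := pow_le_pow_left₀ (pow_pos rho_pos 300).le rho_pow_le q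
  norm_num at this ⊢
  exact this

/-- A summable bound for the contribution of the layers between `2^j` and `2^(j+1)`. -/
def dyadicBound (j : ℕ) : ℝ := 2000000 * ((j : ℝ) ^ 2 * rho ^ j) + 2 * (1 / 2) ^ j

theorem summable_dyadicBound : Summable dyadicBound := by
  refine Summable.add (Summable.mul_left _ ?_) (Summable.mul_left _ ?_)
  · refine summable_pow_mul_geometric_of_norm_lt_one 2 ?_
    rw [Real.norm_eq_abs, abs_of_pos rho_pos, rho]
    norm_num
  · exact summable_geometric_of_lt_one (by norm_num) (by norm_num)

theorem dyadicBound_nonneg (j : ℕ) : 0 ≤ dyadicBound j := by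
  have := rho_pos
  unfold dyadicBound
  positivity

theorem sum_le_dyadicBound {T : Finset ℝ} (hT : OrthoA T) {F : ℝ → ℝ}
    (hF : ∀ t n, F t ≤ weightA n t) {j : ℕ} (hj : 3 ≤ j)
    {lay : ℝ → ℕ} (hlay : ∀ t ∈ T, InLayer (lay t) t)
    (hXl : ∀ t ∈ T, lay t ∈ Finset.Ioc (2 ^ j) (2 * 2 ^ j)) :
    ∑ t ∈ T, F t ≤ dyadicBound j := by
  obtain ⟨i, hjdef⟩ : ∃ i, j = i + 3 := ⟨j - 3, by omega⟩
  -- `b₀ = j - 3` because `6 · 2 ^ (j - 3) ≤ 2 ^ j`. With `b = 300 j`, `rho ^ b ≤ 4 ^ (-j)` beats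
  -- the `2 ^ j` layers. `J` is such that `rho ^ J` beats both the layers and the number `(48 · 2 ^
  -- j) ^ (600 j) ≤ 4 ^ (300 j (j + 6))` of intervals. As `J` is only quadratic in `j`, `J * rho ^
  -- b₀` stays summable.
  have h := sum_dyadic_le hT hF (X := 2 ^ j) (b₀ := i) (b := 300 * j)
    (J := 300 * (j + 300 * j * (j + 6))) Nat.one_le_two_pow
    (by rw [hjdef, pow_add]; omega) hlay hXl
  refine h.trans ?_
  clear h
  have h2j : (0 : ℝ) < 2 ^ j := by positivity
  have hhalf : (2 : ℝ) ^ j * (1 / 2) ^ (2 * j) = (1 / 2) ^ j := by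
    rw [two_mul, pow_add, ← mul_assoc, ← mul_pow]; norm_num
  have a1 : ((300 * (j + 300 * j * (j + 6)) : ℕ) : ℝ) * rho ^ i
      ≤ 2000000 * ((j : ℝ) ^ 2 * rho ^ j) := by
    have hj1 : (1 : ℝ) ≤ j := by
      have : 1 ≤ j := by omega
      exact_mod_cast this
    have h1 : ((300 * (j + 300 * j * (j + 6)) : ℕ) : ℝ) ≤ 700000 * (j : ℝ) ^ 2 := by
      push_cast
      nlinarith
    have h2 : rho ^ i * (2 / 3) ≤ rho ^ j := by
      rw [hjdef, pow_add]
      refine mul_le_mul_of_nonneg_left ?_ (pow_pos rho_pos _).le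
      rw [rho]; norm_num
    have h3 := pow_pos rho_pos i
    calc ((300 * (j + 300 * j * (j + 6)) : ℕ) : ℝ) * rho ^ i
        ≤ 700000 * (j : ℝ) ^ 2 * rho ^ i := mul_le_mul_of_nonneg_right h1 h3.le
      _ ≤ 700000 * (j : ℝ) ^ 2 * (3 / 2 * rho ^ j) := by
          refine mul_le_mul_of_nonneg_left ?_ (by positivity)
          linarith
      _ ≤ _ := by
          have : 0 ≤ (j : ℝ) ^ 2 * rho ^ j := by have := rho_pos; positivity
          nlinarith
  have a2 : ((2 ^ j : ℕ) : ℝ) * rho ^ (300 * j) ≤ (1 / 2) ^ j := by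
    push_cast
    rw [← hhalf]
    exact mul_le_mul_of_nonneg_left (rho_pow_mul_le j) h2j.le
  have a3 : ((2 ^ j : ℕ) : ℝ) * ((48 * ((2 ^ j : ℕ) : ℝ)) ^ (2 * (300 * j)) *
      rho ^ (300 * (j + 300 * j * (j + 6)))) ≤ (1 / 2) ^ j := by
    push_cast
    rw [← hhalf]
    refine mul_le_mul_of_nonneg_left ?_ h2j.le
    have b1 : (48 * (2 : ℝ) ^ j) ^ (2 * (300 * j)) ≤ 2 ^ (2 * (300 * j * (j + 6))) := by
      calc (48 * (2 : ℝ) ^ j) ^ (2 * (300 * j)) ≤ (2 ^ (j + 6)) ^ (2 * (300 * j)) := by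
            refine pow_le_pow_left₀ (by positivity) ?_ _
            rw [pow_add]
            nlinarith
        _ = _ := by
            rw [← pow_mul, show (j + 6) * (2 * (300 * j)) = 2 * (300 * j * (j + 6)) by ring]
    calc (48 * (2 : ℝ) ^ j) ^ (2 * (300 * j)) * rho ^ (300 * (j + 300 * j * (j + 6)))
        ≤ 2 ^ (2 * (300 * j * (j + 6))) * (1 / 2) ^ (2 * (j + 300 * j * (j + 6))) :=
          mul_le_mul b1 (rho_pow_mul_le _) (pow_pos rho_pos _).le (by positivity)
      _ = (1 / 2) ^ (2 * j) := by
          generalize 300 * j * (j + 6) = q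
          rw [mul_add 2 j, pow_add _ (2 * j), mul_left_comm, ← mul_pow]
          norm_num
  refine (add_le_add (add_le_add a1 a2) a3).trans (le_of_eq ?_)
  unfold dyadicBound
  ring

/-! ### Far frequencies carry little mass -/

/-- The layer of a real number. -/
def layerOf (t : ℝ) : ℕ := sInf {K : ℕ | |t| ≤ 9 ^ K / 4}

theorem abs_le_layerOf (t : ℝ) : |t| ≤ 9 ^ layerOf t / 4 := by
  have h : {K : ℕ | |t| ≤ 9 ^ K / 4}.Nonempty := by
    obtain ⟨n, hn⟩ := pow_unbounded_of_one_lt (4 * |t|) (by norm_num : (1 : ℝ) < 9)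
    exact ⟨n, by simp only [Set.mem_ofPred_eq]; linarith⟩
  exact Nat.sInf_mem h

theorem lt_layerOf {A : ℕ} {t : ℝ} (h : 9 ^ A / 4 < |t|) : A < layerOf t := by
  by_contra! hcon
  have h1 := abs_le_layerOf t
  have h2 : (9 : ℝ) ^ layerOf t ≤ 9 ^ A := pow_le_pow_right₀ (by norm_num) hcon
  linarith

theorem inLayer_layerOf {A : ℕ} {t : ℝ} (h : 9 ^ A / 4 < |t|) : InLayer (layerOf t) t := by
  refine ⟨?_, abs_le_layerOf t⟩
  have h1 := lt_layerOf h
  have h2 := Nat.notMem_of_lt_sInf (m := layerOf t - 1) (s := {K : ℕ | |t| ≤ 9 ^ K / 4})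
    (by change layerOf t - 1 < layerOf t; omega)
  simp only [Set.mem_ofPred_eq, not_le] at h2
  obtain ⟨n, hn⟩ : ∃ n, layerOf t = n + 1 := ⟨layerOf t - 1, by omega⟩
  rw [hn, pow_succ]
  rw [hn, Nat.add_sub_cancel] at h2
  linarith

theorem exists_far_mass_le : ∃ A : ℕ, ∀ (T : Finset ℝ) (F : ℝ → ℝ), OrthoA T →
    (∀ t n, F t ≤ weightA n t) → (∀ t ∈ T, 9 ^ A / 4 < |t|) → ∑ t ∈ T, F t ≤ 1 / 2 := by
  classical
  obtain ⟨j₀, h0, h3⟩ := (((tendsto_sum_nat_add dyadicBound).eventually_lt_const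
    (by norm_num : (0 : ℝ) < 1 / 2)).and (eventually_ge_atTop 3)).exists
  refine ⟨2 ^ j₀, fun T F hT hF hA => ?_⟩
  -- Subtracting `1` before the logarithm matches the half-open ranges: `2 ^ g t < layerOf t ≤ 2 * 2
  -- ^ g t`.
  set g : ℝ → ℕ := fun t => Nat.log 2 (layerOf t - 1) with hg
  have hlay : ∀ t ∈ T, InLayer (layerOf t) t := fun t ht => inLayer_layerOf (hA t ht)
  have hlt : ∀ t ∈ T, 2 ^ j₀ < layerOf t := fun t ht => lt_layerOf (hA t ht)
  have hg0 : ∀ t ∈ T, j₀ ≤ g t := fun t ht =>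
    Nat.le_log_of_pow_le (by norm_num) (by have := hlt t ht; omega)
  rw [← Finset.sum_fiberwise_of_maps_to (t := T.image g) (g := g)
    (fun t ht => Finset.mem_image_of_mem g ht)]
  have hstep : ∀ j ∈ T.image g, ∑ t ∈ T.filter (fun t => g t = j), F t ≤ dyadicBound j := by
    intro j hj
    obtain ⟨s, hs, rfl⟩ := Finset.mem_image.1 hj
    refine sum_le_dyadicBound (hT.subset (Finset.filter_subset _ _)) hF
      (h3.trans (hg0 s hs)) (lay := layerOf)
      (fun t ht => hlay t (Finset.mem_filter.1 ht).1) fun t ht => ?_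
    obtain ⟨ht1, ht2⟩ := Finset.mem_filter.1 ht
    have h1 := hlt t ht1
    have h5 : 1 ≤ 2 ^ j₀ := Nat.one_le_two_pow
    have h6 := Nat.pow_log_le_self 2 (x := layerOf t - 1) (by omega)
    have h7 := Nat.lt_pow_succ_log_self (b := 2) (by norm_num) (layerOf t - 1)
    rw [← ht2, Finset.mem_Ioc]
    simp only [hg]
    rw [Nat.succ_eq_add_one, pow_succ] at h7
    omega
  refine (Finset.sum_le_sum hstep).trans ?_
  have hsub : T.image g ⊆ Finset.Ico j₀ ((T.image g).sup id + 1) := by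
    intro j hj
    obtain ⟨s, hs, rfl⟩ := Finset.mem_image.1 hj
    rw [Finset.mem_Ico]
    exact ⟨hg0 s hs, Nat.lt_succ_of_le (Finset.le_sup (f := id) hj)⟩
  refine (Finset.sum_le_sum_of_subset_of_nonneg hsub fun j _ _ => dyadicBound_nonneg j).trans ?_
  rw [Finset.sum_Ico_eq_sum_range]
  simp only [add_comm j₀]
  exact (((summable_nat_add_iff j₀).2 summable_dyadicBound).sum_le_tsum _
    fun j _ => dyadicBound_nonneg _).trans h0.le

/-- An orthogonal set of frequencies has arbitrarily large gaps. -/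
theorem exists_gap {Λ : Set ℝ} (hΛ : ∀ T : Finset ℝ, (T : Set ℝ) ⊆ Λ → OrthoA T) (R : ℕ) :
    ∃ ξ : ℝ, ∀ t ∈ Λ, (R : ℝ) < |ξ + t| := by
  by_contra! hcon
  choose f hfΛ hf using hcon
  -- Without a gap, `Λ` has a point within `R` of each multiple of `Q`. These points are distinct
  -- since `Q > 2 R`, and the first `3 ^ N + 1` of them differ by at most `2 Q 3 ^ N < 9 ^ N`, so
  -- they are orthogonal at levels up to `N`: one too many for the dimension.
  set Q : ℕ := 3 * R + 1 with hQ
  have hQR : (Q : ℝ) = 3 * R + 1 := by rw [hQ]; push_cast; ring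
  obtain ⟨N, hN⟩ := pow_unbounded_of_one_lt (2 * Q : ℝ) (by norm_num : (1 : ℝ) < 3)
  have hR0 : (0 : ℝ) ≤ R := Nat.cast_nonneg R
  set pt : ℕ → ℝ := fun i => f (-((Q : ℝ) * i)) with hpt
  have hpt1 : ∀ i : ℕ, |pt i - Q * i| ≤ R := fun i => by
    have := hf (-((Q : ℝ) * i))
    rwa [neg_add_eq_sub] at this
  have hinj : Function.Injective pt := by
    intro i j hij
    by_contra hne
    have h1 := hpt1 i
    have h2 := hpt1 j
    rw [hij] at h1
    have h3 : |(Q : ℝ) * i - Q * j| ≤ 2 * R := by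
      obtain ⟨h11, h12⟩ := abs_le.1 h1
      obtain ⟨h21, h22⟩ := abs_le.1 h2
      rw [abs_le]
      constructor <;> linarith
    rw [← mul_sub, abs_mul, abs_of_nonneg (by positivity : (0 : ℝ) ≤ Q)] at h3
    have h4 : (1 : ℝ) ≤ |(i : ℝ) - j| := by
      have : (1 : ℤ) ≤ |(i : ℤ) - j| := Int.one_le_abs (by omega)
      exact_mod_cast this
    nlinarith
  set T := (Finset.range (3 ^ N + 1)).map ⟨pt, hinj⟩ with hT
  have hTΛ : (T : Set ℝ) ⊆ Λ := by
    intro t ht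
    simp only [hT, Finset.coe_map, Set.mem_image] at ht
    obtain ⟨i, -, rfl⟩ := ht
    exact hfΛ _
  have hcard := card_le_three_pow (α := fun k => 2 / 9 ^ k) (β := fun k => (4 / 9) ^ k) T N
    (fun t ht s hs hts => by
      obtain ⟨k, hk, hz⟩ := hΛ T hTΛ t ht s hs hts
      refine ⟨k, hk, ?_, hz⟩
      refine nine_pow_lt (le_abs_of_maskA_eq_zero hz) ?_
      simp only [hT, Finset.mem_map, Finset.mem_range, Function.Embedding.coeFn_mk] at ht hs
      obtain ⟨i, hi, rfl⟩ := ht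
      obtain ⟨j, hj, rfl⟩ := hs
      have h1 := abs_le.1 (hpt1 i)
      have h2 := abs_le.1 (hpt1 j)
      have hi' : (i : ℝ) ≤ 3 ^ N := by exact_mod_cast Nat.lt_succ_iff.1 hi
      have hj' : (j : ℝ) ≤ 3 ^ N := by exact_mod_cast Nat.lt_succ_iff.1 hj
      have hQ0 : (0 : ℝ) ≤ Q := by positivity
      have hi0 : (0 : ℝ) ≤ Q * i := by positivity
      have hj0 : (0 : ℝ) ≤ Q * j := by positivity
      have hi1 : (Q : ℝ) * i ≤ Q * 3 ^ N := mul_le_mul_of_nonneg_left hi' hQ0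
      have hj1 : (Q : ℝ) * j ≤ Q * 3 ^ N := mul_le_mul_of_nonneg_left hj' hQ0
      have h3 : (1 : ℝ) ≤ 3 ^ N := one_le_pow₀ (by norm_num)
      have h9 : (9 : ℝ) ^ (N + 1) / 6 = 3 / 2 * (3 ^ N * 3 ^ N) := by
        rw [pow_succ, ← mul_pow]; norm_num; ring
      have h4 : (2 * Q : ℝ) * 3 ^ N < 3 ^ N * 3 ^ N :=
        mul_lt_mul_of_pos_right hN (by positivity)
      have h5 : (2 * R : ℝ) ≤ Q * 3 ^ N := by nlinarith
      rw [h9, abs_lt]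
      constructor <;> nlinarith)
  rw [hT, Finset.card_map, Finset.card_range] at hcard
  omega

/-! ### The first example -/

theorem scaledDigits_A (n : ℕ) : scaledDigits pA DA n = {0, 2 / 9 ^ n, (4 / 9) ^ n} := by
  simp [scaledDigits, pA, DA, Finset.image_insert, div_pow]

theorem isTernary_A : IsTernary pA DA (fun k => 2 / 9 ^ k) (fun k => (4 / 9) ^ k) := by
  intro n hn
  refine ⟨scaledDigits_A n, by positivity, by positivity, ?_⟩
  simp only
  rw [div_pow]
  intro h
  rw [div_left_inj' (by positivity)] at h
  have : (4 : ℝ) ^ 1 ≤ 4 ^ n := pow_le_pow_right₀ (by norm_num) hn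
  linarith

theorem summable_A : Summable fun k : ℕ => |(2 : ℝ) / 9 ^ k| + |((4 : ℝ) / 9) ^ k| := by
  have h1 : Summable fun k : ℕ => (2 : ℝ) / 9 ^ k := by
    have := (summable_geometric_of_lt_one (by norm_num) (by norm_num : (1 / 9 : ℝ) < 1)).mul_left 2
    refine this.congr fun k => ?_
    rw [one_div_pow]; ring
  have h2 : Summable fun k : ℕ => ((4 : ℝ) / 9) ^ k :=
    summable_geometric_of_lt_one (by norm_num) (by norm_num)
  exact h1.abs.add h2.abs

theorem not_isSpectralMeasure_A {μ : ProbabilityMeasure ℝ} (hμ : IsMoranMeasure pA DA μ) :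
    ¬ IsSpectralMeasure μ := by
  rintro ⟨Λ, hΛ⟩
  have hzero : ∀ s ∈ Λ, ∀ t ∈ Λ, s ≠ t → ∃ k, 1 ≤ k ∧ maskA k (t - s) = 0 := by
    intro s hs t ht hst
    have := hΛ.2.1 s hs t ht hst
    rw [inner_expL2] at this
    exact exists_mask_eq_zero isTernary_A hμ summable_A this
  have hortho : ∀ T : Finset ℝ, (T : Set ℝ) ⊆ Λ → OrthoA T := fun T hT t ht s hs hts =>
    hzero t (hT ht) s (hT hs) hts
  obtain ⟨A, hA⟩ := exists_far_mass_le
  obtain ⟨ξ, hξ⟩ := exists_gap hortho (9 ^ A)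
  have hsum := hΛ.hasSum μ ξ
  have hle : ∀ S : Finset Λ, ∑ t ∈ S, ‖ft (μ : Measure ℝ) (ξ + t)‖ ^ 2 ≤ 1 / 2 := by
    intro S
    -- Orthogonality depends on differences only, so the translate by `ξ` is again an orthogonal
    -- set, now of large frequencies.
    set e : Λ ↪ ℝ := ⟨fun t => ξ + t, fun s t h => Subtype.ext (by simpa using h)⟩
    have h := hA (S.map e) (fun t => ‖ft (μ : Measure ℝ) t‖ ^ 2) ?_ ?_ ?_
    · rwa [Finset.sum_map] at h
    · intro t ht s hs hts
      obtain ⟨a, -, rfl⟩ := Finset.mem_map.1 ht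
      obtain ⟨b, -, rfl⟩ := Finset.mem_map.1 hs
      obtain ⟨k, hk, hz⟩ := hzero a a.2 b b.2 fun hab => hts (by rw [Subtype.ext hab])
      refine ⟨k, hk, ?_⟩
      change maskA k (ξ + b - (ξ + a)) = 0
      rwa [add_sub_add_left_eq_sub]
    · intro t n
      simp only [weightA]
      rw [Finset.prod_pow]
      exact pow_le_pow_left₀ (norm_nonneg _) (norm_ft_le isTernary_A hμ t n) 2
    · intro t ht
      obtain ⟨a, -, rfl⟩ := Finset.mem_map.1 ht
      have := hξ a a.2
      push_cast at this
      have h9 : (0 : ℝ) < 9 ^ A := by positivity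
      change 9 ^ A / 4 < |ξ + a|
      linarith
  have := hasSum_le_of_sum_le hsum hle
  norm_num at this

/-! ### The second example -/

/-- The product `p_1 ⋯ p_n` for `p_n = 3 n`. -/
def prodB (n : ℕ) : ℕ := 3 ^ n * n.factorial

theorem prodB_succ (n : ℕ) : prodB (n + 1) = 3 * (n + 1) * prodB n := by
  rw [prodB, prodB, pow_succ, Nat.factorial_succ]; ring

theorem prodB_pos (n : ℕ) : 0 < prodB n := Nat.mul_pos (by positivity) n.factorial_pos

theorem prodB_cast_pos (n : ℕ) : (0 : ℝ) < prodB n := Nat.cast_pos.2 (prodB_pos n)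

theorem prodB_cast_succ (n : ℕ) : (prodB (n + 1) : ℝ) = 3 * (n + 1) * prodB n := by
  rw [prodB_succ]; push_cast; ring

theorem prodB_dvd {m n : ℕ} (h : m ≤ n) : prodB m ∣ prodB n :=
  Nat.mul_dvd_mul (pow_dvd_pow 3 h) (Nat.factorial_dvd_factorial h)

theorem three_pow_le_prodB (n : ℕ) : 3 ^ n ≤ prodB n :=
  Nat.le_mul_of_pos_right _ n.factorial_pos

theorem prod_pB (n : ℕ) : ∏ j ∈ Finset.Icc 1 n, pB j = prodB n := by
  induction n with
  | zero => simp [prodB]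
  | succ n ih =>
    rw [Finset.prod_Icc_succ_top (by omega), ih, prodB_succ, pB]
    push_cast
    ring

/-- The mask of the second example. -/
def maskB (k : ℕ) (t : ℝ) : ℂ := mask (2 / prodB k) ((3 * (k : ℝ) ^ 2 + 1) / prodB k) t

theorem scaledDigits_B (n : ℕ) :
    scaledDigits pB DB n = {0, 2 / (prodB n : ℝ), (3 * (n : ℝ) ^ 2 + 1) / prodB n} := by
  rw [scaledDigits, prod_pB]
  simp [DB, Finset.image_insert]

theorem isTernary_B :
    IsTernary pB DB (fun k => 2 / prodB k) (fun k => (3 * (k : ℝ) ^ 2 + 1) / prodB k) := by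
  intro n hn
  have hP := prodB_cast_pos n
  refine ⟨scaledDigits_B n, by positivity, by positivity, ?_⟩
  simp only
  intro h
  rw [div_left_inj' hP.ne'] at h
  have : (1 : ℝ) ≤ n := by exact_mod_cast hn
  nlinarith

theorem maskB_add {k : ℕ} {z : ℤ} (hz : (prodB k : ℤ) ∣ z) (t : ℝ) :
    maskB k (t + z) = maskB k t := by
  obtain ⟨w, rfl⟩ := hz
  have hP := (prodB_cast_pos k).ne'
  have h1 : (t + ((prodB k * w : ℤ) : ℝ)) * (2 / prodB k) = t * (2 / prodB k) + (2 * w : ℤ) := by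
    push_cast; field_simp
  have h2 : (t + ((prodB k * w : ℤ) : ℝ)) * ((3 * (k : ℝ) ^ 2 + 1) / prodB k)
      = t * ((3 * (k : ℝ) ^ 2 + 1) / prodB k) + ((3 * (k : ℤ) ^ 2 + 1) * w : ℤ) := by
    push_cast; field_simp
  rw [maskB, mask, h1, h2, ex_add_intCast, ex_add_intCast, maskB, mask]

/-- A primitive cube root of unity. -/
def zeta3 : ℂ := ex (1 / 3)

theorem ex_add_third (x : ℝ) : ex (x + 1 / 3) = ex x * zeta3 := ex_add _ _

theorem zeta3_cube : zeta3 ^ 3 = 1 := by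
  have : ex (1 / 3 + 1 / 3 + 1 / 3) = 1 := (ex_eq_one_iff _).2 ⟨1, by norm_num⟩
  rw [ex_add, ex_add] at this
  rw [← this, zeta3]; ring

theorem zeta3_ne_one : zeta3 ≠ 1 := by
  intro h
  obtain ⟨n, hn⟩ := (ex_eq_one_iff _).1 h
  have : (1 : ℝ) = 3 * n := by linarith
  have : (1 : ℤ) = 3 * n := by exact_mod_cast this
  omega

theorem zeta3_sum : 1 + zeta3 + zeta3 ^ 2 = 0 := by
  have h := zeta3_cube
  have h1 : (zeta3 - 1) * (1 + zeta3 + zeta3 ^ 2) = 0 := by linear_combination h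
  exact (mul_eq_zero.1 h1).resolve_left (sub_ne_zero.2 zeta3_ne_one)

/-- The shift is `c` thirds of `prodB (n + 1)`. As the last digit `3 (n + 1)² + 1` is `1` modulo
`3`, the two phases turn by `2c` and `c` thirds. -/
theorem maskB_succ_add (n : ℕ) (t : ℝ) (c : ℕ) :
    maskB (n + 1) (t + (c * (prodB n * (n + 1)) : ℕ))
      = (1 + ex (t * (2 / prodB (n + 1))) * zeta3 ^ (2 * c)
        + ex (t * ((3 * ((n + 1 : ℕ) : ℝ) ^ 2 + 1) / prodB (n + 1))) * zeta3 ^ c) / 3 := by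
  have hP := (prodB_cast_pos n).ne'
  have hn : (n : ℝ) + 1 ≠ 0 := by positivity
  have hz : ∀ (x : ℝ) (c : ℕ), ex (x + c * (1 / 3)) = ex x * zeta3 ^ c := by
    intro x c
    induction c with
    | zero => simp
    | succ c ih =>
      rw [pow_succ, ← mul_assoc, ← ih, ← ex_add_third]
      push_cast
      ring_nf
  have h1 : (t + ((c * (prodB n * (n + 1)) : ℕ) : ℝ)) * (2 / prodB (n + 1))
      = t * (2 / prodB (n + 1)) + (2 * c : ℕ) * (1 / 3) := by
    rw [prodB_cast_succ]; push_cast; field_simp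
  have h2 : (t + ((c * (prodB n * (n + 1)) : ℕ) : ℝ)) *
        ((3 * ((n + 1 : ℕ) : ℝ) ^ 2 + 1) / prodB (n + 1))
      = t * ((3 * ((n + 1 : ℕ) : ℝ) ^ 2 + 1) / prodB (n + 1)) + c * (1 / 3)
        + (c * (n + 1) ^ 2 : ℤ) := by
    rw [prodB_cast_succ]; push_cast; field_simp; ring
  rw [maskB, mask, h1, h2, ex_add_intCast, hz, hz]

theorem maskB_succ_eq_zero (n : ℕ) {j : ℤ} (hj : ¬ (3 : ℤ) ∣ j) :
    maskB (n + 1) ((prodB n * (n + 1) * j : ℤ) : ℝ) = 0 := by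
  obtain ⟨c, q, hc, rfl⟩ : ∃ (c : ℕ) (q : ℤ), (c = 1 ∨ c = 2) ∧ j = c + 3 * q :=
    ⟨(j % 3).toNat, j / 3, by omega, by omega⟩
  have hd : (prodB (n + 1) : ℤ) ∣ (prodB (n + 1) * q : ℤ) := dvd_mul_right _ _
  have h := maskB_succ_add n 0 c
  rw [← maskB_add hd] at h
  have he : (0 : ℝ) + ((c * (prodB n * (n + 1)) : ℕ) : ℝ) + ((prodB (n + 1) * q : ℤ) : ℝ)
      = ((prodB n * (n + 1) * (c + 3 * q) : ℤ) : ℝ) := by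
    push_cast; rw [prodB_cast_succ]; ring
  rw [he] at h
  rw [h, zero_mul, zero_mul, ex_zero]
  rcases hc with rfl | rfl
  · linear_combination zeta3_sum / 3
  · linear_combination zeta3_sum / 3 + zeta3 * zeta3_cube / 3

/-- Parseval for the Fourier transform on `ℤ/3`, applied to a vector with three unimodular entries.
-/
theorem sum_norm_sq_cube {u v : ℂ} (hu : ‖u‖ = 1) (hv : ‖v‖ = 1) :
    ‖(1 + u + v) / 3‖ ^ 2 + ‖(1 + u * zeta3 ^ 2 + v * zeta3) / 3‖ ^ 2
      + ‖(1 + u * zeta3 ^ 4 + v * zeta3 ^ 2) / 3‖ ^ 2 = 1 := by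
  have h1 : ∀ z : ℂ, ‖z‖ = 1 → z * (starRingEnd ℂ) z = 1 := fun z hz => by
    rw [Complex.mul_conj, Complex.normSq_eq_norm_sq, hz]; simp
  have hconj : (starRingEnd ℂ) zeta3 = zeta3 ^ 2 := by
    linear_combination zeta3 ^ 2 * h1 zeta3 (norm_ex _) - (starRingEnd ℂ) zeta3 * zeta3_cube
  have h4 : zeta3 ^ 4 = zeta3 := by linear_combination zeta3 * zeta3_cube
  have hsq : ∀ z : ℂ, ((‖z‖ ^ 2 : ℝ) : ℂ) = z * (starRingEnd ℂ) z := fun z => by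
    rw [Complex.mul_conj, Complex.normSq_eq_norm_sq]
  rw [h4, ← Complex.ofReal_inj, Complex.ofReal_add, Complex.ofReal_add, hsq, hsq, hsq,
    Complex.ofReal_one]
  simp only [map_div₀, map_add, map_mul, map_pow, map_one, map_ofNat, hconj]
  have hq : zeta3 * zeta3 ^ 2 = 1 := by linear_combination zeta3_cube
  have hs := zeta3_sum
  have hu' := h1 u hu
  have hv' := h1 v hv
  have h22 : (zeta3 ^ 2) ^ 2 = zeta3 := by linear_combination zeta3 * zeta3_cube
  rw [h22]
  generalize zeta3 ^ 2 = q at *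
  generalize zeta3 = w at *
  generalize (starRingEnd ℂ) u = U at *
  generalize (starRingEnd ℂ) v = V at *
  linear_combination ((U + V + u + v + (u * V + v * U) * (w + q - 1)) * hs
    + (2 * (u * U + v * V) - 2 * (u * V + v * U)) * hq + 3 * hu' + 3 * hv') / 9

theorem sum_norm_sq_maskB (n : ℕ) (t : ℝ) :
    ‖maskB (n + 1) t‖ ^ 2 + ‖maskB (n + 1) (t + (prodB n * (n + 1) : ℕ))‖ ^ 2
      + ‖maskB (n + 1) (t + (2 * (prodB n * (n + 1)) : ℕ))‖ ^ 2 = 1 := by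
  have h1 := maskB_succ_add n t 1
  have h2 := maskB_succ_add n t 2
  rw [one_mul, mul_one, pow_one] at h1
  rw [h1, h2]
  exact sum_norm_sq_cube (norm_ex _) (norm_ex _)

/-! ### The spectrum of the second example -/

/-- The number with ternary digits `m_k` is sent to `∑ m_k p_1 ⋯ p_{k+1} / 3`. -/
def lamB (m : ℕ) : ℕ := ∑ k ∈ Finset.range m, m / 3 ^ k % 3 * (prodB k * (k + 1))

theorem lamB_eq {m n : ℕ} (h : m < 3 ^ n) :
    lamB m = ∑ k ∈ Finset.range n, m / 3 ^ k % 3 * (prodB k * (k + 1)) := by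
  have key : ∀ a b, a ≤ b → m < 3 ^ a →
      ∑ k ∈ Finset.range a, m / 3 ^ k % 3 * (prodB k * (k + 1))
        = ∑ k ∈ Finset.range b, m / 3 ^ k % 3 * (prodB k * (k + 1)) := by
    intro a b hab ha
    refine Finset.sum_subset (Finset.range_subset_range.2 hab) fun k _ hk => ?_
    rw [Finset.mem_range, not_lt] at hk
    rw [Nat.div_eq_of_lt (ha.trans_le (Nat.pow_le_pow_right (by norm_num) hk))]
    simp
  have hm : m < 3 ^ m := Nat.lt_pow_self (by norm_num)
  rcases le_total m n with hmn | hmn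
  · exact key m n hmn hm
  · exact (key n m hmn h).symm

theorem lamB_add {n m c : ℕ} (hm : m < 3 ^ n) (hc : c < 3) :
    lamB (m + c * 3 ^ n) = lamB m + c * (prodB n * (n + 1)) := by
  have h : m + c * 3 ^ n < 3 ^ (n + 1) := by
    rw [pow_succ]
    have : c * 3 ^ n ≤ 2 * 3 ^ n := Nat.mul_le_mul_right _ (by omega)
    omega
  rw [lamB_eq h, lamB_eq hm, Finset.sum_range_succ,
    Nat.add_mul_div_right _ _ (by positivity), Nat.div_eq_of_lt hm, zero_add,
    Nat.mod_eq_of_lt hc]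
  congr 1
  refine Finset.sum_congr rfl fun k hk => ?_
  have hk' := Finset.mem_range.1 hk
  obtain ⟨d, rfl⟩ : ∃ d, n = k + d + 1 := ⟨n - k - 1, by omega⟩
  rw [show c * 3 ^ (k + d + 1) = c * 3 ^ d * 3 * 3 ^ k by ring,
    Nat.add_mul_div_right _ _ (by positivity), Nat.add_mul_mod_self_right]

/-- Gives `|ξ + lamB m| ≤ 2 * prodB n` once `|ξ| ≤ prodB n`, the range in which the later masks are
controlled. -/
theorem lamB_le {n m : ℕ} (hm : m < 3 ^ n) : lamB m ≤ prodB n := by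
  induction n generalizing m with
  | zero =>
    obtain rfl : m = 0 := by simpa using hm
    simp [lamB]
  | succ n ih =>
    have hc : m / 3 ^ n < 3 := by
      rw [Nat.div_lt_iff_lt_mul (by positivity)]
      rwa [pow_succ, mul_comm] at hm
    have h1 := Nat.mod_lt m (show 3 ^ n > 0 by positivity)
    rw [← Nat.mod_add_div' m (3 ^ n), lamB_add h1 hc, prodB_succ]
    have h2 := ih h1
    have h3 : m / 3 ^ n * (prodB n * (n + 1)) ≤ 2 * (prodB n * (n + 1)) :=
      Nat.mul_le_mul_right _ (by omega)
    nlinarith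

/-- `k` is the lowest ternary digit in which `m` and `m'` differ; all higher digits contribute
multiples of `prodB (k + 1)`, a period of the mask of level `k + 1`. -/
theorem lamB_sub {n m m' : ℕ} (hm : m < 3 ^ n) (hm' : m' < 3 ^ n) (hne : m ≠ m') :
    ∃ (k : ℕ) (j z : ℤ), k < n ∧ ¬ (3 : ℤ) ∣ j ∧
      (lamB m : ℤ) - lamB m' = prodB k * (k + 1) * j + prodB (k + 1) * z := by
  induction n generalizing m m' with
  | zero =>
    rw [pow_zero, Nat.lt_one_iff] at hm hm'
    omega
  | succ n ih =>
    have hc : ∀ a, a < 3 ^ (n + 1) → a / 3 ^ n < 3 := fun a ha => by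
      rw [Nat.div_lt_iff_lt_mul (by positivity)]
      rwa [pow_succ, mul_comm] at ha
    have h1 : ∀ a, a % 3 ^ n < 3 ^ n := fun a => Nat.mod_lt a (by positivity)
    have he := Nat.mod_add_div' m (3 ^ n)
    have he' := Nat.mod_add_div' m' (3 ^ n)
    have hl := lamB_add (h1 m) (hc m hm)
    have hl' := lamB_add (h1 m') (hc m' hm')
    have hc1 := hc m hm
    have hc2 := hc m' hm'
    rw [he] at hl
    rw [he'] at hl'
    by_cases hmod : m % 3 ^ n = m' % 3 ^ n
    · refine ⟨n, (m / 3 ^ n : ℕ) - (m' / 3 ^ n : ℕ), 0, by omega, ?_, ?_⟩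
      · intro hdvd
        have : m / 3 ^ n = m' / 3 ^ n := by
          clear he he' hl hl'
          generalize m / 3 ^ n = a at *
          generalize m' / 3 ^ n = b at *
          omega
        rw [hmod, this, he'] at he
        exact hne he.symm
      · rw [hl, hl', hmod]
        push_cast
        ring
    · obtain ⟨k, j, z, hk, hj, hz⟩ := ih (h1 m) (h1 m') hmod
      obtain ⟨w, hw⟩ := prodB_dvd (show k + 1 ≤ n from hk)
      refine ⟨k, j, z + w * (n + 1) * ((m / 3 ^ n : ℕ) - (m' / 3 ^ n : ℕ)), by omega, hj, ?_⟩
      rw [hl, hl']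
      have hw' : (prodB n : ℤ) = prodB (k + 1) * w := by exact_mod_cast hw
      push_cast
      rw [hw']
      linear_combination hz

theorem ft_lamB_sub {μ : ProbabilityMeasure ℝ} (hμ : IsMoranMeasure pB DB μ) {m m' : ℕ}
    (hne : m ≠ m') : ft (μ : Measure ℝ) ((lamB m : ℝ) - lamB m') = 0 := by
  have hlt : ∀ a b : ℕ, a < 3 ^ (a + b) := fun a b =>
    (Nat.lt_pow_self (by norm_num)).trans_le (Nat.pow_le_pow_right (by norm_num) (by omega))
  obtain ⟨k, j, z, -, hj, hz⟩ := lamB_sub (n := m + m') (hlt m m')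
    (by rw [add_comm]; exact hlt m' m) hne
  have hz' : (lamB m : ℝ) - lamB m'
      = ((prodB k * (k + 1) * j : ℤ) : ℝ) + ((prodB (k + 1) * z : ℤ) : ℝ) := by
    exact_mod_cast hz
  refine ft_eq_zero_of_mask isTernary_B hμ (k := k + 1) (by omega) ?_
  change maskB (k + 1) _ = 0
  rw [hz', maskB_add (dvd_mul_right _ _), maskB_succ_eq_zero k hj]

/-- A new top digit changes the frequency by a period of the first `n` masks, and its three values
sum out the mask of level `n + 1`. -/
theorem sum_prod_maskB (ξ : ℝ) (n : ℕ) :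
    ∑ m ∈ Finset.range (3 ^ n), ∏ k ∈ Finset.Icc 1 n, ‖maskB k (ξ + lamB m)‖ ^ 2 = 1 := by
  induction n with
  | zero => simp
  | succ n ih =>
    have hstep : ∀ c < 3, ∀ m ∈ Finset.range (3 ^ n),
        ∏ k ∈ Finset.Icc 1 (n + 1), ‖maskB k (ξ + lamB (m + c * 3 ^ n))‖ ^ 2
          = (∏ k ∈ Finset.Icc 1 n, ‖maskB k (ξ + lamB m)‖ ^ 2) *
            ‖maskB (n + 1) (ξ + lamB m + (c * (prodB n * (n + 1)) : ℕ))‖ ^ 2 := by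
      intro c hc m hm
      rw [lamB_add (Finset.mem_range.1 hm) hc, Nat.cast_add, ← add_assoc,
        Finset.prod_Icc_succ_top (by omega)]
      congr 1
      refine Finset.prod_congr rfl fun k hk => ?_
      have hd : (prodB k : ℤ) ∣ ((c * (prodB n * (n + 1)) : ℕ) : ℤ) :=
        Int.natCast_dvd_natCast.2 (((prodB_dvd (Finset.mem_Icc.1 hk).2).mul_right _).mul_left _)
      have := maskB_add hd (ξ + lamB m)
      rw [Int.cast_natCast] at this
      rw [this]
    have h0 := Finset.sum_congr rfl (hstep 0 (by norm_num))
    have h1 := Finset.sum_congr rfl (hstep 1 (by norm_num))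
    have h2 := Finset.sum_congr rfl (hstep 2 (by norm_num))
    simp only [zero_mul, one_mul, add_zero, Nat.cast_zero] at h0 h1
    rw [show 3 ^ (n + 1) = 3 ^ n + 3 ^ n + 3 ^ n by ring, Finset.sum_range_add,
      Finset.sum_range_add, h0]
    have h3 : ∀ x, 3 ^ n + x = x + 3 ^ n := fun x => add_comm _ _
    have h4 : ∀ x, 3 ^ n + 3 ^ n + x = x + 2 * 3 ^ n := fun x => by ring
    simp_rw [h4, h3]
    rw [h1, h2, ← Finset.sum_add_distrib, ← Finset.sum_add_distrib, ← ih]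
    refine Finset.sum_congr rfl fun m _ => ?_
    rw [← mul_add, ← mul_add, sum_norm_sq_maskB, mul_one]

/-! ### A lower bound for the Fourier transform in the second example -/

/-- Control of one phase suffices: `|1 + z + w| ≥ 2 - |1 - z| - 1 ≥ 1/2`, whatever the unimodular
`w` is. This serves the levels just after `n`, where the large digit is not yet negligible. -/
theorem le_norm_mask {a b t : ℝ} (h : |t * a| ≤ 1 / 16) : 1 / 6 ≤ ‖mask a b t‖ := by
  have h1 := norm_ex_sub_one_le (t * a)
  have h2 : ‖(1 + ex (t * a) + ex (t * b))‖ ≥ 1 / 2 := by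
    have e : (1 + ex (t * a) + ex (t * b)) = 2 - (1 - ex (t * a) - ex (t * b)) := by ring
    have h3 := norm_sub_norm_le (2 : ℂ) (1 - ex (t * a) - ex (t * b))
    have h4 := norm_sub_le (1 - ex (t * a)) (ex (t * b))
    rw [norm_ex, norm_sub_rev 1 (ex (t * a))] at h4
    rw [e]
    have h5 : ‖(2 : ℂ)‖ = 2 := by simp
    have := Real.pi_lt_four
    nlinarith [abs_nonneg (t * a)]
  rw [mask, norm_div, show ‖(3 : ℂ)‖ = 3 by simp]
  linarith

theorem le_norm_maskB {n k : ℕ} (hn : 22 ≤ n) (hk : n < k) {x : ℝ} (hx : |x| ≤ 2 * prodB n) :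
    1 / 6 ≤ ‖maskB k x‖ := by
  refine le_norm_mask ?_
  have hP := prodB_cast_pos n
  have hk' := prodB_cast_pos k
  have h1 : (3 * ((n : ℝ) + 1)) * prodB n ≤ prodB k := by
    rw [← prodB_cast_succ]
    exact_mod_cast Nat.le_of_dvd (prodB_pos k) (prodB_dvd hk)
  have hn' : (22 : ℝ) ≤ n := by exact_mod_cast hn
  rw [abs_mul, abs_of_pos (by positivity : (0 : ℝ) < 2 / prodB k), ← mul_div_assoc,
    div_le_iff₀ hk']
  nlinarith

theorem three_pow_mul_prodB_le (n i : ℕ) : 3 ^ i * prodB n ≤ prodB (n + i) := by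
  induction i with
  | zero => simp
  | succ i ih =>
    rw [← add_assoc, prodB_succ, pow_succ]
    nlinarith [prodB_pos (n + i)]

/-- With `k = n + 3 + i`, the last two factors of `prodB k` contribute `9 k (k - 1)` and absorb the
digit `3 k² + 1`; the factor `3 (n + 1)` at level `n + 1` and the remaining powers of `3` give the
decay. -/
theorem norm_maskB_sub_one_le {n : ℕ} (i : ℕ) {x : ℝ} (hx : |x| ≤ 2 * prodB n) :
    ‖maskB (n + 3 + i) x - 1‖ ≤ 2 / (n + 1) * (1 / 3) ^ i := by
  have hP := prodB_cast_pos n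
  set k : ℝ := n + 3 + i with hk
  have hn0 : (0 : ℝ) ≤ n := Nat.cast_nonneg n
  have hi0 : (0 : ℝ) ≤ i := Nat.cast_nonneg i
  have hk2 : (3 : ℝ) ≤ k := by linarith
  have h1 : (3 : ℝ) ^ i * (3 * (n + 1) * prodB n) ≤ prodB (n + 1 + i) := by
    rw [← prodB_cast_succ]
    exact_mod_cast three_pow_mul_prodB_le (n + 1) i
  have h2 : (prodB (n + 3 + i) : ℝ) = 9 * k * (k - 1) * prodB (n + 1 + i) := by
    rw [show n + 3 + i = n + 1 + i + 1 + 1 by ring, prodB_cast_succ, prodB_cast_succ]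
    push_cast
    rw [hk]
    ring
  have h3 : 27 / 2 * k ^ 2 * ((n + 1) * 3 ^ i * prodB n) ≤ prodB (n + 3 + i) := by
    rw [h2]
    have hq := prodB_cast_pos (n + 1 + i)
    have h4 : 9 / 2 * k ^ 2 ≤ 9 * k * (k - 1) := by nlinarith
    calc 27 / 2 * k ^ 2 * ((n + 1) * 3 ^ i * prodB n)
        = 9 / 2 * k ^ 2 * (3 ^ i * (3 * (n + 1) * prodB n)) := by ring
      _ ≤ 9 / 2 * k ^ 2 * prodB (n + 1 + i) := mul_le_mul_of_nonneg_left h1 (by positivity)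
      _ ≤ _ := mul_le_mul_of_nonneg_right h4 hq.le
  have hq := prodB_cast_pos (n + 3 + i)
  refine (norm_mask_sub_one_le _ _ _).trans ?_
  have hkc : ((n + 3 + i : ℕ) : ℝ) = k := by push_cast; rfl
  have he : 2 * Real.pi / 3 * ((2 / (prodB (n + 3 + i) : ℝ)
      + (3 * k ^ 2 + 1) / prodB (n + 3 + i)) * |x|)
      = 2 * Real.pi / 3 * ((2 + (3 * k ^ 2 + 1)) * |x|) / prodB (n + 3 + i) := by
    rw [← add_div]; ring
  rw [hkc, abs_of_pos (by positivity), abs_of_pos (by positivity), he, one_div_pow,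
    div_mul_div_comm, mul_one, div_le_div_iff₀ hq (by positivity)]
  have hpi := Real.pi_lt_d2
  have hpi0 := Real.pi_pos
  have h5 : (2 + (3 * k ^ 2 + 1)) * |x| ≤ 4 * k ^ 2 * (2 * prodB n) :=
    mul_le_mul (by nlinarith) hx (abs_nonneg x) (by positivity)
  have h6 : 2 * Real.pi / 3 ≤ 3 := by linarith
  calc 2 * Real.pi / 3 * ((2 + (3 * k ^ 2 + 1)) * |x|) * ((n + 1) * 3 ^ i)
      ≤ 3 * (4 * k ^ 2 * (2 * prodB n)) * ((n + 1) * 3 ^ i) :=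
        mul_le_mul_of_nonneg_right (mul_le_mul h6 h5 (by positivity) (by norm_num))
          (by positivity)
    _ = 24 * (k ^ 2 * ((n + 1) * 3 ^ i * prodB n)) := by ring
    _ ≤ 27 * (k ^ 2 * ((n + 1) * 3 ^ i * prodB n)) :=
        mul_le_mul_of_nonneg_right (by norm_num) (by positivity)
    _ ≤ 2 * prodB (n + 3 + i) := by linarith

/-- Levels `n + 1` and `n + 2` cost at most a factor `6` each, and all later levels together at most
a factor `2`, whence `72`. -/
theorem prod_maskB_le_norm_ft {μ : ProbabilityMeasure ℝ} (hμ : IsMoranMeasure pB DB μ) {n : ℕ}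
    (hn : 22 ≤ n) {x : ℝ} (hx : |x| ≤ 2 * prodB n) :
    ∏ k ∈ Finset.Icc 1 n, ‖maskB k x‖ ≤ 72 * ‖ft (μ : Measure ℝ) x‖ := by
  obtain ⟨c, hc⟩ : ∃ c, c = ∏ k ∈ Finset.Icc 1 n, ‖maskB k x‖ := ⟨_, rfl⟩
  rw [← hc]
  have hc0 : 0 ≤ c := hc ▸ Finset.prod_nonneg fun k _ => norm_nonneg _
  have hsplit : ∀ i, ∏ k ∈ Finset.Icc 1 (n + 2 + i), ‖maskB k x‖
      = c * (‖maskB (n + 1) x‖ * ‖maskB (n + 2) x‖) *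
        ∏ j ∈ Finset.range i, ‖maskB (n + 3 + j) x‖ := by
    intro i
    induction i with
    | zero =>
      rw [add_zero, Finset.prod_Icc_succ_top (by omega), Finset.prod_Icc_succ_top (by omega)]
      simp [hc, mul_assoc]
    | succ i ih =>
      rw [← add_assoc, Finset.prod_Icc_succ_top (by omega), ih, Finset.prod_range_succ,
        show n + 2 + i + 1 = n + 3 + i by ring, mul_assoc]
  have hlow : ∀ i, c / 72 ≤ ∏ k ∈ Finset.Icc 1 (n + 2 + i), ‖maskB k x‖ := by
    intro i
    rw [hsplit]
    have h1 := le_norm_maskB hn (show n < n + 1 by omega) hx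
    have h2 := le_norm_maskB hn (show n < n + 2 by omega) hx
    have h3 : 1 / 2 ≤ ∏ j ∈ Finset.range i, ‖maskB (n + 3 + j) x‖ := by
      refine le_trans ?_ (one_sub_sum_le_prod_norm (Finset.range i)
        (fun j => maskB (n + 3 + j) x) fun _ _ => norm_mask_le _ _ _)
      have hsum : ∑ j ∈ Finset.range i, ‖maskB (n + 3 + j) x - 1‖ ≤ 1 / 2 := by
        refine (Finset.sum_le_sum fun j _ => norm_maskB_sub_one_le j hx).trans ?_
        rw [← Finset.mul_sum]
        have hg : ∑ j ∈ Finset.range i, (1 / 3 : ℝ) ^ j ≤ 3 / 2 := by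
          have := (summable_geometric_of_lt_one (by norm_num)
            (by norm_num : (1 / 3 : ℝ) < 1)).sum_le_tsum (Finset.range i)
            fun _ _ => by positivity
          rw [tsum_geometric_of_lt_one (by norm_num) (by norm_num)] at this
          refine this.trans (by norm_num)
        have hn' : (22 : ℝ) ≤ n := by exact_mod_cast hn
        have h4 : 2 / ((n : ℝ) + 1) ≤ 1 / 3 := by
          rw [div_le_iff₀ (by positivity)]; linarith
        calc 2 / ((n : ℝ) + 1) * ∑ j ∈ Finset.range i, (1 / 3 : ℝ) ^ j ≤ 1 / 3 * (3 / 2) :=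
              mul_le_mul h4 hg (Finset.sum_nonneg fun _ _ => by positivity) (by norm_num)
          _ = 1 / 2 := by norm_num
      linarith
    have h4 : (1 / 6 : ℝ) * (1 / 6) ≤ ‖maskB (n + 1) x‖ * ‖maskB (n + 2) x‖ :=
      mul_le_mul h1 h2 (by norm_num) (by positivity)
    calc c / 72 = c * (1 / 6 * (1 / 6)) * (1 / 2) := by ring
      _ ≤ _ := mul_le_mul (mul_le_mul_of_nonneg_left h4 hc0) h3 (by norm_num)
        (mul_nonneg hc0 (by positivity))
  have : c / 72 ≤ ‖ft (μ : Measure ℝ) x‖ := by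
    refine ge_of_tendsto (tendsto_ft isTernary_B hμ x).norm ?_
    filter_upwards [eventually_ge_atTop (n + 2)] with m hm
    obtain ⟨i, rfl⟩ := Nat.exists_eq_add_of_le hm
    rw [norm_prod]
    exact hlow i
  linarith

/-- The level-`n` sums are exactly `1`. They converge termwise, and from some `n` on the terms are
dominated by `72 ^ 2 * F m`; here `F` is summable because it lies below the level-`n` products. -/
theorem hasSum_ft_lamB {μ : ProbabilityMeasure ℝ} (hμ : IsMoranMeasure pB DB μ) (ξ : ℝ) :
    HasSum (fun m : ℕ => ‖ft (μ : Measure ℝ) (ξ + lamB m)‖ ^ 2) 1 := by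
  set F : ℕ → ℝ := fun m => ‖ft (μ : Measure ℝ) (ξ + lamB m)‖ ^ 2 with hF
  set g : ℕ → ℕ → ℝ := fun n m => if m ∈ Finset.range (3 ^ n) then
    ∏ k ∈ Finset.Icc 1 n, ‖maskB k (ξ + lamB m)‖ ^ 2 else 0 with hg
  have hlt : ∀ m : ℕ, m < 3 ^ m := fun m => Nat.lt_pow_self (by norm_num)
  have hFle : ∀ m n, F m ≤ ∏ k ∈ Finset.Icc 1 n, ‖maskB k (ξ + lamB m)‖ ^ 2 := fun m n => by
    rw [Finset.prod_pow]
    exact pow_le_pow_left₀ (norm_nonneg _) (norm_ft_le isTernary_B hμ _ n) 2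
  have hFs : Summable F := by
    refine summable_of_sum_range_le (c := 1) (fun m => by positivity) fun n => ?_
    rw [← sum_prod_maskB ξ n]
    refine (Finset.sum_le_sum fun m _ => hFle m n).trans
      (Finset.sum_le_sum_of_subset_of_nonneg
        (Finset.range_subset_range.2 (hlt n).le) fun m _ _ => ?_)
    exact Finset.prod_nonneg fun k _ => by positivity
  have hgsum : ∀ n, ∑' m, g n m = 1 := fun n => by
    rw [tsum_eq_sum (s := Finset.range (3 ^ n)) fun m hm => if_neg hm, ← sum_prod_maskB ξ n]
    exact Finset.sum_congr rfl fun m hm => if_pos hm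
  have hlim : Tendsto (fun n => ∑' m, g n m) atTop (𝓝 (∑' m, F m)) := by
    refine tendsto_tsum_of_dominated_convergence (bound := fun m => 72 ^ 2 * F m)
      (hFs.mul_left _) (fun m => ?_) ?_
    · refine ((tendsto_ft isTernary_B hμ (ξ + lamB m)).norm.pow 2).congr' ?_
      filter_upwards [eventually_ge_atTop m] with n hn
      have hm : m ∈ Finset.range (3 ^ n) :=
        Finset.mem_range.2 ((hlt m).trans_le (Nat.pow_le_pow_right (by norm_num) hn))
      rw [hg]
      simp only [hm, if_true]
      rw [norm_prod, Finset.prod_pow]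
      rfl
    -- `n ≥ |ξ|` ensures `|ξ| ≤ 3 ^ n ≤ prodB n`; `n ≥ 22` is what the lower bound for the later
    -- masks requires.
    · obtain ⟨N, hN⟩ := exists_nat_ge |ξ|
      filter_upwards [eventually_ge_atTop N, eventually_ge_atTop 22] with n hn hn2 m
      have hF0 : 0 ≤ F m := by positivity
      rw [hg]
      simp only
      split_ifs with hm
      · have hx : |ξ + lamB m| ≤ 2 * prodB n := by
          have h1 : (lamB m : ℝ) ≤ prodB n := by
            exact_mod_cast lamB_le (Finset.mem_range.1 hm)
          have h2 : |ξ| ≤ prodB n := by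
            refine hN.trans ?_
            exact_mod_cast hn.trans ((hlt n).le.trans (three_pow_le_prodB n))
          refine (abs_add_le _ _).trans ?_
          rw [Nat.abs_cast]
          linarith
        rw [Finset.prod_pow, Real.norm_of_nonneg (by positivity), hF]
        simp only
        rw [← mul_pow]
        exact pow_le_pow_left₀ (Finset.prod_nonneg fun k _ => norm_nonneg _)
          (prod_maskB_le_norm_ft hμ hn2 hx) 2
      · rw [norm_zero]
        positivity
  simp only [hgsum] at hlim
  rw [tendsto_nhds_unique tendsto_const_nhds hlim]
  exact hFs.hasSum

theorem isSpectralMeasure_B {μ : ProbabilityMeasure ℝ} (hμ : IsMoranMeasure pB DB μ) :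
    IsSpectralMeasure μ :=
  ⟨_, isSpectrum_range μ (fun m : ℕ => (lamB m : ℝ)) (fun _ _ h => ft_lamB_sub hμ h)
    (hasSum_ft_lamB hμ)⟩

/-! ### Hadamard triples, unbounded digits and existence of the measures -/

theorem ex_div_three (j : ℤ) : ex (j / 3) = zeta3 ^ (j % 3).toNat := by
  have h : (j : ℝ) / 3 = ((j % 3).toNat : ℝ) * (1 / 3) + (j / 3 : ℤ) := by
    have h1 : (j : ℝ) = 3 * (j / 3 : ℤ) + (j % 3 : ℤ) := by
      exact_mod_cast (Int.mul_ediv_add_emod j 3).symm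
    have h2 : ((j % 3).toNat : ℝ) = (j % 3 : ℤ) := by
      exact_mod_cast Int.toNat_of_nonneg (Int.emod_nonneg j (by norm_num))
    rw [h2]
    linarith
  rw [h, ex_add_intCast]
  generalize (j % 3).toNat = c
  induction c with
  | zero => simp [ex_zero]
  | succ c ih =>
    rw [pow_succ, ← ih, ← ex_add_third]
    push_cast
    ring_nf

theorem one_add_ex_add_ex_eq_zero {j : ℤ} (hj : ¬ (3 : ℤ) ∣ j) :
    1 + ex (j / 3) + ex ((2 * j : ℤ) / 3) = 0 := by
  rw [ex_div_three, ex_div_three]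
  have h : j % 3 = 1 ∨ j % 3 = 2 := by omega
  rcases h with h | h
  · rw [h, show (2 * j) % 3 = 2 by omega]
    change 1 + zeta3 ^ 1 + zeta3 ^ 2 = 0
    linear_combination zeta3_sum
  · rw [h, show (2 * j) % 3 = 1 by omega]
    change 1 + zeta3 ^ 2 + zeta3 ^ 1 = 0
    linear_combination zeta3_sum

/-- Three digits that are pairwise distinct modulo `3` form a Hadamard triple with `R = 3 r`. -/
theorem isHadamardTriple_of_mod_three {r : ℤ} (hr : 0 < r) {D : Finset ℤ} (hD : D.card = 3)
    (h3 : ∀ d ∈ D, ∀ d' ∈ D, d ≠ d' → ¬ (3 : ℤ) ∣ d' - d) :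
    IsHadamardTriple (3 * r) D {0, r, 2 * r} := by
  have hL : ({0, r, 2 * r} : Finset ℤ).card = 3 :=
    Finset.card_eq_three.2 ⟨0, r, 2 * r, by omega, by omega, by omega, rfl⟩
  refine ⟨by rw [abs_of_pos (by omega)]; omega, by rw [hD, hL], ?_⟩
  intro H
  have hr' : (r : ℂ) ≠ 0 := by exact_mod_cast hr.ne'
  have hs : (((1 / Real.sqrt 3 : ℝ)) : ℂ) * ((1 / Real.sqrt 3 : ℝ) : ℂ) = 1 / 3 := by
    rw [← Complex.ofReal_mul, div_mul_div_comm, Real.mul_self_sqrt (by norm_num)]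
    push_cast
    ring
  have hH : ∀ (d : D) (l : ({0, r, 2 * r} : Finset ℤ)),
      H l d = ((1 / Real.sqrt 3 : ℝ) : ℂ) * ex ((d : ℤ) * (l : ℤ) / (3 * r : ℤ)) := by
    intro d l
    simp only [H, Matrix.of_apply, hD, ex]
    push_cast
    rfl
  ext d d'
  -- For `l = 0, r, 2 r` the phase `(d' - d) l / (3 r)` is `0`, `1` or `2` thirds of `d' - d`, so
  -- only residues modulo `3` matter.
  have hent : (H.conjTranspose * H) d d'
      = (1 + ex (((d' : ℤ) - d : ℤ) / 3) + ex ((2 * ((d' : ℤ) - d) : ℤ) / 3)) / 3 := by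
    rw [Matrix.mul_apply]
    have hterm : ∀ l : ({0, r, 2 * r} : Finset ℤ), H.conjTranspose d l * H l d'
        = (fun l : ℤ => 1 / 3 * ex (((d' : ℤ) - d : ℤ) * l / (3 * r))) l := by
      intro l
      rw [Matrix.conjTranspose_apply, hH, hH, star_mul', ← starRingEnd_apply,
        ← starRingEnd_apply, Complex.conj_ofReal, ← ex_neg, mul_mul_mul_comm, hs, ← ex_add]
      congr 2
      push_cast
      ring
    rw [Finset.sum_congr rfl fun l _ => hterm l,
      Finset.sum_coe_sort ({0, r, 2 * r} : Finset ℤ)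
        (fun l : ℤ => 1 / 3 * ex (((d' : ℤ) - d : ℤ) * l / (3 * r))),
      Finset.sum_insert (by simp; omega), Finset.sum_insert (by simp; omega),
      Finset.sum_singleton]
    have hr0 : (r : ℝ) ≠ 0 := by exact_mod_cast hr.ne'
    have e1 : (((d' : ℤ) - d : ℤ) : ℝ) * r / (3 * r) = (((d' : ℤ) - d : ℤ) : ℝ) / 3 := by
      field_simp
    have e2 : (((d' : ℤ) - d : ℤ) : ℝ) * (2 * r : ℤ) / (3 * r)
        = ((2 * ((d' : ℤ) - d) : ℤ) : ℝ) / 3 := by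
      push_cast; field_simp
    rw [e1, e2, Int.cast_zero, mul_zero, zero_div, ex_zero]
    ring
  rw [hent]
  by_cases hdd : d = d'
  · subst hdd
    simp [ex_zero]
    norm_num
  · rw [Matrix.one_apply_ne hdd, one_add_ex_add_ex_eq_zero
      (h3 d d.2 d' d'.2 fun h => hdd (Subtype.ext h)), zero_div]

theorem four_pow_mod_three (n : ℕ) : (4 : ℤ) ^ n % 3 = 1 := by
  induction n with
  | zero => rfl
  | succ n ih => rw [pow_succ]; omega

theorem isHadamardSequence_A : IsHadamardSequence pA DA := by
  refine ⟨⟨fun _ => {0, 3, 2 * 3}, fun n hn => ?_⟩, 3, fun n _ => Finset.card_le_three⟩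
  have h4 := four_pow_mod_three n
  have hpos : (0 : ℤ) < 4 ^ n := by positivity
  refine isHadamardTriple_of_mod_three (r := 3) (by norm_num) ?_ ?_
  · exact Finset.card_eq_three.2 ⟨0, 2, 4 ^ n, by norm_num, by omega, by omega, rfl⟩
  · intro d hd d' hd' hne
    simp only [DA, Finset.mem_insert, Finset.mem_singleton] at hd hd'
    rcases hd with rfl | rfl | rfl <;> rcases hd' with rfl | rfl | rfl <;> omega

theorem isHadamardSequence_B : IsHadamardSequence pB DB := by
  refine ⟨⟨fun n => {0, (n : ℤ), 2 * (n : ℤ)}, fun n hn => ?_⟩, 3, fun n _ => Finset.card_le_three⟩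
  refine isHadamardTriple_of_mod_three (r := n) (by omega) ?_ ?_
  · exact Finset.card_eq_three.2 ⟨0, 2, 3 * (n : ℤ) ^ 2 + 1, by norm_num, by omega, by omega, rfl⟩
  · intro d hd d' hd' hne
    simp only [DB, Finset.mem_insert, Finset.mem_singleton] at hd hd'
    rcases hd with rfl | rfl | rfl <;> rcases hd' with rfl | rfl | rfl <;> omega

theorem not_boundedDigits_A : ¬ BoundedDigits pA DA := by
  rintro ⟨C, hC⟩
  obtain ⟨n, hn⟩ := pow_unbounded_of_one_lt (9 * C) (by norm_num : (1 : ℝ) < 4)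
  have h := hC ⟨n + 1, by omega, 4 ^ (n + 1), by simp [DA], rfl⟩
  have h4 : (0 : ℝ) < 4 ^ n := by positivity
  simp only [pA] at h
  push_cast at h
  rw [div_le_iff₀ (by norm_num), pow_succ] at h
  linarith

theorem not_boundedDigits_B : ¬ BoundedDigits pB DB := by
  rintro ⟨C, hC⟩
  obtain ⟨n, hn⟩ := exists_nat_gt C
  have h := hC ⟨n + 1, by omega, 3 * ((n + 1 : ℕ) : ℤ) ^ 2 + 1, by simp [DB], rfl⟩
  simp only [pB] at h
  push_cast at h
  rw [div_le_iff₀ (by positivity)] at h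
  have : (0 : ℝ) ≤ n := Nat.cast_nonneg n
  nlinarith

theorem exists_isMoranMeasure_A : ∃ μ, IsMoranMeasure pA DA μ := by
  refine exists_isMoranMeasure (fun n hn => isTernary_A.nonempty n hn)
    ((summable_nat_add_iff 1).2 summable_A) fun n x hx => ?_
  rw [scaledDigits_A] at hx
  simp only [Finset.mem_insert, Finset.mem_singleton] at hx
  rcases hx with rfl | rfl | rfl
  · rw [abs_zero]; positivity
  · exact le_add_of_nonneg_right (abs_nonneg _)
  · exact le_add_of_nonneg_left (abs_nonneg _)

theorem two_add_digit_le (n : ℕ) :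
    2 / (prodB (n + 1) : ℝ) + (3 * ((n + 1 : ℕ) : ℝ) ^ 2 + 1) / prodB (n + 1)
      ≤ 6 * ((n : ℝ) + 1) ^ 2 * (1 / 3) ^ (n + 1) := by
  have h : (3 : ℝ) ^ (n + 1) ≤ prodB (n + 1) := by exact_mod_cast three_pow_le_prodB (n + 1)
  have hn : (0 : ℝ) ≤ n := Nat.cast_nonneg n
  rw [← add_div, one_div_pow, mul_one_div]
  push_cast
  exact div_le_div₀ (by positivity) (by nlinarith) (by positivity) h

theorem exists_isMoranMeasure_B : ∃ μ, IsMoranMeasure pB DB μ := by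
  have hs : Summable fun n : ℕ => 6 * ((n : ℝ) + 1) ^ 2 * (1 / 3) ^ (n + 1) := by
    have h := (summable_pow_mul_geometric_of_norm_lt_one 2
      (show ‖(1 / 3 : ℝ)‖ < 1 by norm_num)).mul_left 6
    refine ((summable_nat_add_iff 1).2 h).congr fun n => ?_
    push_cast
    ring
  refine exists_isMoranMeasure (fun n hn => isTernary_B.nonempty n hn) hs fun n x hx => ?_
  have h1 := two_add_digit_le n
  have hP := prodB_cast_pos (n + 1)
  have h2 : 0 ≤ 2 / (prodB (n + 1) : ℝ) := by positivity
  have h3 : 0 ≤ (3 * ((n + 1 : ℕ) : ℝ) ^ 2 + 1) / prodB (n + 1) := by positivity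
  rw [scaledDigits_B] at hx
  simp only [Finset.mem_insert, Finset.mem_singleton] at hx
  rcases hx with rfl | rfl | rfl
  · rw [abs_zero]; positivity
  · rw [abs_of_nonneg h2]; linarith
  · rw [abs_of_nonneg h3]; linarith

end CantorMoran

end

theorem mainTheorem5 :
    (CantorMoran.IsHadamardSequence CantorMoran.pA CantorMoran.DA ∧
      ¬ CantorMoran.BoundedDigits CantorMoran.pA CantorMoran.DA ∧
      (∃ μ : ProbabilityMeasure ℝ, CantorMoran.IsMoranMeasure CantorMoran.pA CantorMoran.DA μ) ∧
      ∀ μ : ProbabilityMeasure ℝ, CantorMoran.IsMoranMeasure CantorMoran.pA CantorMoran.DA μ →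
        ¬ CantorMoran.IsSpectralMeasure μ) ∧
    (CantorMoran.IsHadamardSequence CantorMoran.pB CantorMoran.DB ∧
      ¬ CantorMoran.BoundedDigits CantorMoran.pB CantorMoran.DB ∧
      (∃ μ : ProbabilityMeasure ℝ, CantorMoran.IsMoranMeasure CantorMoran.pB CantorMoran.DB μ) ∧
      ∀ μ : ProbabilityMeasure ℝ, CantorMoran.IsMoranMeasure CantorMoran.pB CantorMoran.DB μ →
        CantorMoran.IsSpectralMeasure μ) :=
  ⟨⟨CantorMoran.isHadamardSequence_A, CantorMoran.not_boundedDigits_A,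
      CantorMoran.exists_isMoranMeasure_A, fun _ => CantorMoran.not_isSpectralMeasure_A⟩,
    CantorMoran.isHadamardSequence_B, CantorMoran.not_boundedDigits_B,
    CantorMoran.exists_isMoranMeasure_B, fun _ => CantorMoran.isSpectralMeasure_B⟩
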